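/- Let $V:\mathbb R\to[0,\infty)$ be smooth and even with $0<\delta_-\le V''(r)\le\delta_+<\infty$ for all $r$ and $\delta_- /\delta_+>(3/4)^{1/16}$, and let $\beta,\gamma>0$. On $\Omega=(\mathbb R^2)^{\mathbb Z}$, with points $\omega=(p_i,r_i)_{i\in\mathbb Z}$, let $\nu_\beta=\prod_i \frac{e^{-\beta(p_i^2/2+V(r_i))}}{\sqrt{2\pi\beta^{-1}}\,Z_\beta}\,dp_i\,dr_i$ with $Z_\beta=\int_{\mathbb R} e^{-\beta V(r)}dr$, write $\langle\cdot\rangle_\beta$ for the expectation under $\nu_\beta$, $\mathcal E_i=p_i^2/2+V(r_i)$, and let $\tau_j$ be the shift, $\tau_jp_i=p_{i+j}$, $\tau_jr_i=r_{i+j}$. Put $$Y_{i,j}=p_i\partial_{r_j}-V'(r_j)\partial_{p_i},\qquad X_i=Y_{i,i},\qquad L=\frac{\gamma}{2}\sum_{i\in\mathbb Z}\{X_i^2+Y_{i,i+1}^2\}+\sum_{i\in\mathbb Z}\{X_i-Y_{i,i+1}\},$$ $$W_{0,1}=-p_0V'(r_1)+\frac{\gamma}{2}\{p_0^2V''(r_1)-V'(r_1)^2\}.$$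 Let $\mathcal C$ be the set of smooth local functions on $\Omega$ (functions of finitely many coordinates) with compact support (in those coordinates) and zero $\nu_\beta$-average, and for $g\in\mathcal C$ let $\Gamma_g=\sum_{j\in\mathbb Z}\tau_jg$ (a formal sum; $X_0\Gamma_g$ and $Y_{0,1}\Gamma_g$ are finite sums). For a local function $h\in L^2(\nu_\beta)$ of zero average define $$|\!|\!|h|\!|\!|_{-1}^2=\sup_{g\in\mathcal C,\,a\in\mathbb R}\Big\{2\sum_{i\in\mathbb Z}\langle g\,\tau_ih\rangle_\beta+2a\sum_{i\in\mathbb Z}i\,\langle h\,\mathcal E_i\rangle_\beta-\frac{\gamma}{2}\big\langle(a\,p_0V'(r_1)+Y_{0,1}\Gamma_g)^2\big\rangle_\beta-\frac{\gamma}{2}\big\langle(X_0\Gamma_g)^2\big\rangle_\beta\Big\}.$$ Let $\kappa_\beta$ be the diffusion constant, i.e. the real number $\kappa$ such that $W_{0,1}+\kappa\,(p_1^2-p_0^2)$ belongs to the closure of $L\mathcal C=\{LF: F\in\mathcal C\}$ with respect to $|\!|\!|\cdot|\!|\!|_{-1}$, that is, $\inf_{F\in\mathcal C}|\!|\!|W_{0,1}+\kappa\,(p_1^2-p_0^2)-LF|\!|\!|_{-1}=0$.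 Then every real number with this property, and so $\kappa_\beta$, satisfies $$\kappa_\beta\le\frac{\gamma}{4}\,\langle V''(r_0)\rangle_\beta+\frac{3}{4\gamma}.$$ -/

import Mathlib

open MeasureTheory

namespace AnharmonicChain

noncomputable section

/-- Configurations of the infinite chain: `ω i = (p_i, r_i)`. -/
abbrev Conf : Type := ℤ → ℝ × ℝ

/-- Partition function `Z_β = ∫ exp (-β V(r)) dr`. -/
def partitionZ (V : ℝ → ℝ) (β : ℝ) : ℝ := ∫ r : ℝ, Real.exp (-β * V r)

/-- One-site Gibbs measure
`exp (-β (p²/2 + V(r))) / (√(2π β⁻¹) Z_β) dp dr` on `ℝ × ℝ`. -/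
def siteMeasure (V : ℝ → ℝ) (β : ℝ) : Measure (ℝ × ℝ) :=
  (volume : Measure (ℝ × ℝ)).withDensity fun x =>
    ENNReal.ofReal
      (Real.exp (-β * (x.1 ^ 2 / 2 + V x.2)) / (√(2 * Real.pi * β⁻¹) * partitionZ V β))

/-- The Gibbs measure `ν_β` on the infinite chain. -/
def gibbs (V : ℝ → ℝ) (β : ℝ) : Measure Conf :=
  Measure.infinitePi fun _ : ℤ => siteMeasure V β

/-- Expectation `⟨f⟩_β`. -/
def avg (V : ℝ → ℝ) (β : ℝ) (f : Conf → ℝ) : ℝ := ∫ ω, f ω ∂(gibbs V β)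

/-- Shift of functions, `(τ_j f)(ω) = f ((ω_{i+j})_i)`; thus `τ_j p_i = p_{i+j}`. -/
def shift (j : ℤ) (f : Conf → ℝ) : Conf → ℝ := fun ω => f fun i => ω (i + j)

/-- `∂f/∂p_i`. -/
def dP (i : ℤ) (f : Conf → ℝ) : Conf → ℝ := fun ω =>
  deriv (fun x : ℝ => f (Function.update ω i (x, (ω i).2))) (ω i).1

/-- `∂f/∂r_i`. -/
def dR (i : ℤ) (f : Conf → ℝ) : Conf → ℝ := fun ω =>
  deriv (fun x : ℝ => f (Function.update ω i ((ω i).1, x))) (ω i).2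

/-- `Y_{i,j} = p_i ∂_{r_j} - V'(r_j) ∂_{p_i}`. -/
def opY (V : ℝ → ℝ) (i j : ℤ) (f : Conf → ℝ) : Conf → ℝ := fun ω =>
  (ω i).1 * dR j f ω - deriv V (ω j).2 * dP i f ω

/-- `X_i = Y_{i,i}`. -/
def opX (V : ℝ → ℝ) (i : ℤ) (f : Conf → ℝ) : Conf → ℝ := opY V i i f

/-- `A f = ∑_i (X_i f - Y_{i,i+1} f)`; for a local function the sum is finite. -/
def opA (V : ℝ → ℝ) (f : Conf → ℝ) : Conf → ℝ := fun ω =>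
  ∑ᶠ i : ℤ, (opX V i f ω - opY V i (i + 1) f ω)

/-- `S f = (γ/2) ∑_i (X_i² f + Y_{i,i+1}² f)`; for a local function the sum is finite. -/
def opS (V : ℝ → ℝ) (γ : ℝ) (f : Conf → ℝ) : Conf → ℝ := fun ω =>
  γ / 2 * ∑ᶠ i : ℤ,
    (opX V i (opX V i f) ω + opY V i (i + 1) (opY V i (i + 1) f) ω)

/-- The generator `L = S + A`. -/
def opL (V : ℝ → ℝ) (γ : ℝ) (f : Conf → ℝ) : Conf → ℝ := fun ω => opS V γ f ω + opA V f ω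

/-- The class `𝒞` of smooth local functions with compact support (as functions of the finitely
many coordinates they depend on) and zero average with respect to `ν_β`. -/
def testFunctions (V : ℝ → ℝ) (β : ℝ) : Set (Conf → ℝ) :=
  {f | (∃ (Λ : Finset ℤ) (φ : (Λ → ℝ × ℝ) → ℝ),
      ContDiff ℝ ((⊤ : ℕ∞) : WithTop ℕ∞) φ ∧ HasCompactSupport φ ∧ ∀ ω : Conf, f ω = φ fun i => ω i) ∧
    avg V β f = 0}

/-- `X_0 Γ_g`, where `Γ_g = ∑_j τ_j g` is a formal sum: for a local `g` only finitely many
of the terms `X_0 (τ_j g)` are non-zero. -/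
def XGamma (V : ℝ → ℝ) (g : Conf → ℝ) : Conf → ℝ := fun ω =>
  ∑ᶠ j : ℤ, opX V 0 (shift j g) ω

/-- `Y_{0,1} Γ_g`. -/
def YGamma (V : ℝ → ℝ) (g : Conf → ℝ) : Conf → ℝ := fun ω =>
  ∑ᶠ j : ℤ, opY V 0 1 (shift j g) ω

/-- Energy of the `i`-th oscillator, `ℰ_i = p_i²/2 + V(r_i)`. -/
def energy (V : ℝ → ℝ) (i : ℤ) : Conf → ℝ := fun ω => (ω i).1 ^ 2 / 2 + V (ω i).2

/-- `≪g, h≫_* = ∑_i ⟨g τ_i h⟩`; for local functions of zero average the sum is finite. -/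
def starForm (V : ℝ → ℝ) (β : ℝ) (g h : Conf → ℝ) : ℝ :=
  ∑ᶠ i : ℤ, avg V β fun ω => g ω * shift i h ω

/-- `≪h≫_** = ∑_i i ⟨h ℰ_i⟩`; for a local function of zero average the sum is finite. -/
def starStarForm (V : ℝ → ℝ) (β : ℝ) (h : Conf → ℝ) : ℝ :=
  ∑ᶠ i : ℤ, (i : ℝ) * avg V β fun ω => h ω * energy V i ω

/-- The squared semi-norm
`⦀h⦀²_{-1} = sup_{g ∈ 𝒞, a ∈ ℝ} { 2 ≪g,h≫_* + 2 a ≪h≫_**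
    - (γ/2) ⟨(a p_0 V'(r_1) + Y_{0,1} Γ_g)²⟩ - (γ/2) ⟨(X_0 Γ_g)²⟩ }`,
as an extended real number. -/
def seminormSq (V : ℝ → ℝ) (β γ : ℝ) (h : Conf → ℝ) : EReal :=
  ⨆ g ∈ testFunctions V β, ⨆ a : ℝ,
    ((2 * starForm V β g h + 2 * a * starStarForm V β h
      - γ / 2 * avg V β (fun ω => (a * ((ω 0).1 * deriv V (ω 1).2) + YGamma V g ω) ^ 2)
      - γ / 2 * avg V β (fun ω => XGamma V g ω ^ 2) : ℝ) : EReal)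

/-- The microscopic energy current
`W_{0,1} = -p_0 V'(r_1) + (γ/2) (p_0² V''(r_1) - V'(r_1)²)`. -/
def current (V : ℝ → ℝ) (γ : ℝ) : Conf → ℝ := fun ω =>
  -(ω 0).1 * deriv V (ω 1).2
    + γ / 2 * ((ω 0).1 ^ 2 * deriv (deriv V) (ω 1).2 - deriv V (ω 1).2 ^ 2)

/-- `κ` is the diffusion constant `κ_β`: the number `κ` such that `W_{0,1} + κ (p_1² - p_0²)`
lies in the closure of `L𝒞` for the semi-norm `⦀·⦀_{-1}`. -/
def IsDiffusionConstant (V : ℝ → ℝ) (β γ κ : ℝ) : Prop :=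
  ∀ ε : ℝ, 0 < ε → ∃ F ∈ testFunctions V β,
    seminormSq V β γ
      (fun ω => current V γ ω + κ * ((ω 1).1 ^ 2 - (ω 0).1 ^ 2) - opL V γ F ω) < (ε : EReal)

/-- The standing assumptions on the potential and the inverse temperature. -/
structure Admissible (V : ℝ → ℝ) (δm δp β : ℝ) : Prop where
  nonneg : ∀ r, 0 ≤ V r
  smooth : ContDiff ℝ ((⊤ : ℕ∞) : WithTop ℕ∞) V
  symm : ∀ r, V (-r) = V r
  pos : 0 < δm
  lower : ∀ r, δm ≤ deriv (deriv V) r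
  upper : ∀ r, deriv (deriv V) r ≤ δp
  beta_pos : 0 < β

section Potential

variable {V : ℝ → ℝ} {δm δp β : ℝ}

lemma Admissible.differentiable (h : Admissible V δm δp β) : Differentiable ℝ V :=
  h.smooth.differentiable (by simp)

lemma Admissible.contDiff_deriv (h : Admissible V δm δp β) :
    ContDiff ℝ ((⊤ : ℕ∞) : WithTop ℕ∞) (deriv V) :=
  (contDiff_infty_iff_deriv.1 h.smooth).2

lemma Admissible.differentiable_deriv (h : Admissible V δm δp β) :
    Differentiable ℝ (deriv V) :=
  h.contDiff_deriv.differentiable (by simp)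

lemma Admissible.continuous_deriv (h : Admissible V δm δp β) : Continuous (deriv V) :=
  h.differentiable_deriv.continuous

lemma Admissible.continuous_deriv_deriv (h : Admissible V δm δp β) :
    Continuous (deriv (deriv V)) :=
  (contDiff_infty_iff_deriv.1 h.contDiff_deriv).2.continuous

lemma Admissible.abs_deriv_deriv_le (h : Admissible V δm δp β) (r : ℝ) :
    |deriv (deriv V) r| ≤ δp := by
  rw [abs_of_pos (h.pos.trans_le (h.lower r))]
  exact h.upper r

lemma Admissible.deriv_zero (h : Admissible V δm δp β) : deriv V 0 = 0 := by
  have h1 : deriv (fun r => V (-r)) 0 = deriv V 0 := by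
    congr 1
    exact funext h.symm
  rw [deriv_comp_neg, neg_zero] at h1
  linarith

lemma Admissible.abs_deriv_le (h : Admissible V δm δp β) (r : ℝ) :
    |deriv V r| ≤ δp * |r| := by
  have := Convex.norm_image_sub_le_of_norm_deriv_le (f := deriv V) (C := δp) (s := Set.univ)
    (x := 0) (y := r) (fun x _ => h.differentiable_deriv x)
    (fun x _ => h.abs_deriv_deriv_le x) convex_univ trivial trivial
  simpa [h.deriv_zero] using this

lemma Admissible.le_mul_sq (h : Admissible V δm δp β) (r : ℝ) :
    V r ≤ V 0 + δp * r ^ 2 := by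
  have hδp : 0 ≤ δp := (abs_nonneg _).trans (h.abs_deriv_deriv_le 0)
  have := Convex.norm_image_sub_le_of_norm_deriv_le (f := V) (C := δp * |r|)
    (s := Set.Icc (-|r|) |r|) (x := 0) (y := r) (fun x _ => h.differentiable x)
    (fun x hx => (h.abs_deriv_le x).trans
      (mul_le_mul_of_nonneg_left (abs_le.2 hx) hδp)) (convex_Icc _ _)
    (by simp) (abs_le.1 le_rfl)
  have h2 := (abs_le.1 this).2
  have h3 : δp * |r| * ‖r - 0‖ = δp * r ^ 2 := by
    rw [sub_zero, Real.norm_eq_abs, mul_assoc, abs_mul_abs_self, sq]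
  linarith

lemma Admissible.mul_sq_le (h : Admissible V δm δp β) (r : ℝ) : δm / 2 * r ^ 2 ≤ V r := by
  have hd : deriv (fun r => V r - δm / 2 * r ^ 2) = fun r => deriv V r - δm * r := by
    funext x
    have := (h.differentiable x).hasDerivAt.sub ((hasDerivAt_pow 2 x).const_mul (δm / 2))
    refine (HasDerivAt.deriv (f := fun r => V r - δm / 2 * r ^ 2) this).trans ?_
    norm_num
    ring
  have hdd : deriv (fun r => deriv V r - δm * r) = fun r => deriv (deriv V) r - δm := by
    funext x
    have := (h.differentiable_deriv x).hasDerivAt.sub ((hasDerivAt_id x).const_mul δm)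
    simpa using HasDerivAt.deriv (f := fun r => deriv V r - δm * r) this
  have hc : ConvexOn ℝ Set.univ (fun r => V r - δm / 2 * r ^ 2) := by
    refine convexOn_univ_of_deriv2_nonneg ?_ ?_ ?_
    · exact h.differentiable.sub (by fun_prop)
    · rw [hd]
      exact h.differentiable_deriv.sub (by fun_prop)
    · intro x
      rw [Function.iterate_succ, Function.iterate_one, Function.comp_apply, hd, hdd]
      linarith [h.lower x]
  have h1 := hc.2 (Set.mem_univ r) (Set.mem_univ (-r)) 
    (by norm_num : (0 : ℝ) ≤ 1 / 2) (by norm_num : (0 : ℝ) ≤ 1 / 2) (by norm_num)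
  simp only [smul_eq_mul, h.symm] at h1
  have h2 : (1 / 2 : ℝ) * r + 1 / 2 * -r = 0 := by ring
  rw [h2] at h1
  have h3 := h.nonneg 0
  nlinarith

end Potential

section Site

variable {V : ℝ → ℝ} {δm δp β : ℝ}

lemma integrable_abs_pow_mul_exp {b : ℝ} (hb : 0 < b) (k : ℕ) :
    Integrable (fun x : ℝ => |x| ^ k * Real.exp (-b * x ^ 2)) := by
  have h := (integrable_rpow_mul_exp_neg_mul_sq hb (s := k)
    (by have : (0 : ℝ) ≤ k := k.cast_nonneg
        linarith)).norm
  refine h.congr (Filter.Eventually.of_forall fun x => ?_)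
  simp [Real.rpow_natCast]

lemma Admissible.integrable_pow_mul_exp (h : Admissible V δm δp β) (k : ℕ) :
    Integrable (fun r : ℝ => |r| ^ k * Real.exp (-β * V r)) := by
  refine (integrable_abs_pow_mul_exp (b := β * (δm / 2))
    (mul_pos h.beta_pos (half_pos h.pos)) k).mono' ?_ (Filter.Eventually.of_forall fun r => ?_)
  · have := h.differentiable.continuous
    exact (by fun_prop : Continuous _).aestronglyMeasurable
  · rw [Real.norm_eq_abs, abs_of_nonneg (by positivity)]
    refine mul_le_mul_of_nonneg_left (Real.exp_le_exp.2 ?_) (by positivity)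
    nlinarith [mul_le_mul_of_nonneg_left (h.mul_sq_le r) h.beta_pos.le]

lemma Admissible.partitionZ_pos (h : Admissible V δm δp β) : 0 < partitionZ V β := by
  have h0 := h.integrable_pow_mul_exp 0
  simp only [pow_zero, one_mul] at h0
  exact integral_exp_pos h0

/-- The density of the one-site measure. -/
def siteDensity (V : ℝ → ℝ) (β : ℝ) (x : ℝ × ℝ) : ℝ :=
  Real.exp (-β * (x.1 ^ 2 / 2 + V x.2)) / (√(2 * Real.pi * β⁻¹) * partitionZ V β)

lemma siteDensity_eq (x : ℝ × ℝ) :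
    siteDensity V β x = Real.exp (-(β / 2) * x.1 ^ 2) / √(2 * Real.pi * β⁻¹) *
      (Real.exp (-β * V x.2) / partitionZ V β) := by
  rw [siteDensity, div_mul_div_comm, ← Real.exp_add]
  congr 2
  ring

lemma Admissible.siteDensity_nonneg (h : Admissible V δm δp β) (x : ℝ × ℝ) :
    0 ≤ siteDensity V β x :=
  div_nonneg (Real.exp_nonneg _) (mul_nonneg (Real.sqrt_nonneg _) h.partitionZ_pos.le)

lemma Admissible.measurable_siteDensity (h : Admissible V δm δp β) :
    Measurable (siteDensity V β) := by
  have := h.differentiable.continuous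
  unfold siteDensity
  exact (by fun_prop : Continuous _).measurable

lemma siteMeasure_eq :
    siteMeasure V β = volume.withDensity fun x => ENNReal.ofReal (siteDensity V β x) := rfl

lemma Admissible.integrable_site_iff (h : Admissible V δm δp β) {f : ℝ × ℝ → ℝ} :
    Integrable f (siteMeasure V β) ↔ Integrable fun x => siteDensity V β x * f x := by
  rw [siteMeasure_eq, integrable_withDensity_iff_integrable_smul'
    h.measurable_siteDensity.ennreal_ofReal (by simp)]
  simp [ENNReal.toReal_ofReal (h.siteDensity_nonneg _)]

lemma Admissible.integral_site (h : Admissible V δm δp β) (f : ℝ × ℝ → ℝ) :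
    ∫ x, f x ∂siteMeasure V β = ∫ x, siteDensity V β x * f x := by
  rw [siteMeasure_eq, integral_withDensity_eq_integral_toReal_smul
    h.measurable_siteDensity.ennreal_ofReal (by simp)]
  simp [ENNReal.toReal_ofReal (h.siteDensity_nonneg _)]

lemma Admissible.integrable_siteDensity_mul (h : Admissible V δm δp β) (k l : ℕ) :
    Integrable fun x : ℝ × ℝ => siteDensity V β x * (|x.1| ^ k * |x.2| ^ l) := by
  have h1 := (integrable_abs_pow_mul_exp (half_pos h.beta_pos) k).div_const
    √(2 * Real.pi * β⁻¹)
  have h2 := (h.integrable_pow_mul_exp l).div_const (partitionZ V β)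
  refine (h1.mul_prod h2).congr (Filter.Eventually.of_forall fun x => ?_)
  simp only [siteDensity_eq]
  ring

lemma Admissible.isProbabilityMeasure_site (h : Admissible V δm δp β) :
    IsProbabilityMeasure (siteMeasure V β) := by
  have h1 := h.integrable_siteDensity_mul 0 0
  simp only [pow_zero, mul_one] at h1
  constructor
  rw [siteMeasure_eq, withDensity_apply _ MeasurableSet.univ, Measure.restrict_univ,
    ← ofReal_integral_eq_lintegral_ofReal h1
      (Filter.Eventually.of_forall h.siteDensity_nonneg)]
  simp only [siteDensity_eq]
  rw [Measure.volume_eq_prod, integral_prod_mul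
    (fun p : ℝ => Real.exp (-(β / 2) * p ^ 2) / √(2 * Real.pi * β⁻¹))
    (fun r : ℝ => Real.exp (-β * V r) / partitionZ V β), integral_div, integral_div,
    integral_gaussian]
  have hb := h.beta_pos
  have e : Real.pi / (β / 2) = 2 * Real.pi * β⁻¹ := by field_simp
  rw [e, div_self, ← partitionZ, div_self h.partitionZ_pos.ne', one_mul, ENNReal.ofReal_one]
  exact (Real.sqrt_pos.2 (by positivity)).ne'

lemma Admissible.integrable_site_pow (h : Admissible V δm δp β) (k l : ℕ) :
    Integrable (fun x : ℝ × ℝ => |x.1| ^ k * |x.2| ^ l) (siteMeasure V β) :=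
  h.integrable_site_iff.2 (h.integrable_siteDensity_mul k l)

/-- Integration by parts against the one-site measure, in the direction `v`. -/
lemma Admissible.site_integral_lineDeriv (h : Admissible V δm δp β) {v : ℝ × ℝ}
    {φ φ' : ℝ × ℝ → ℝ} (hφ : ∀ x, HasLineDerivAt ℝ φ (φ' x) x v)
    (hi : Integrable φ (siteMeasure V β)) (hi' : Integrable φ' (siteMeasure V β))
    (hi'' : Integrable (fun x => (v.1 * x.1 + v.2 * deriv V x.2) * φ x) (siteMeasure V β)) :
    ∫ x, φ' x ∂siteMeasure V β
      = β * ∫ x, (v.1 * x.1 + v.2 * deriv V x.2) * φ x ∂siteMeasure V β := by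
  have hw : ∀ x, HasLineDerivAt ℝ (siteDensity V β)
      (-β * (v.1 * x.1 + v.2 * deriv V x.2) * siteDensity V β x) x v := by
    intro x
    have h1 : HasDerivAt (fun t : ℝ => x.1 + t * v.1) v.1 0 := by
      simpa using ((hasDerivAt_id (0 : ℝ)).mul_const v.1).const_add x.1
    have h2 : HasDerivAt (fun t : ℝ => x.2 + t * v.2) v.2 0 := by
      simpa using ((hasDerivAt_id (0 : ℝ)).mul_const v.2).const_add x.2
    have h3 : HasDerivAt (fun t : ℝ => V (x.2 + t * v.2)) (deriv V x.2 * v.2) 0 := by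
      have hV : HasDerivAt V (deriv V x.2) (x.2 + 0 * v.2) := by
        simpa using (h.differentiable x.2).hasDerivAt
      exact hV.comp (0 : ℝ) h2
    have h4 := ((((h1.pow 2).div_const 2).add h3).const_mul (-β)).exp.div_const
      (√(2 * Real.pi * β⁻¹) * partitionZ V β)
    refine HasDerivAt.congr_deriv h4 ?_
    simp [siteDensity]
    ring
  rw [h.integrable_site_iff] at hi hi' hi''
  have key := integral_bilinear_hasLineDerivAt_right_eq_neg_left_of_integrable
    (μ := (volume : Measure (ℝ × ℝ))) (f := siteDensity V β) (g := φ) (v := v)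
    (f' := fun x => -β * (v.1 * x.1 + v.2 * deriv V x.2) * siteDensity V β x) (g' := φ')
    (B := ContinuousLinearMap.mul ℝ ℝ)
    (by refine (hi''.const_mul (-β)).congr (Filter.Eventually.of_forall fun x => ?_)
        simp only [ContinuousLinearMap.mul_apply']
        ring)
    (by simpa using hi') (by simpa using hi) (fun x _ => hw x) (fun x _ => hφ x)
  simp only [ContinuousLinearMap.mul_apply'] at key
  rw [h.integral_site, h.integral_site, key, ← integral_neg, ← integral_const_mul]
  congr 1
  funext x
  ring

end Site

section Gibbs

variable {V : ℝ → ℝ} {δm δp β : ℝ}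

lemma Admissible.isProbabilityMeasure_gibbs (h : Admissible V δm δp β) :
    IsProbabilityMeasure (gibbs V β) := by
  have := h.isProbabilityMeasure_site
  unfold gibbs
  infer_instance

lemma Admissible.measurePreserving_shift (h : Admissible V δm δp β) (j : ℤ) :
    MeasurePreserving (fun (ω : Conf) i => ω (i + j)) (gibbs V β) (gibbs V β) := by
  have := h.isProbabilityMeasure_site
  refine ⟨by fun_prop, ?_⟩
  exact Measure.map_infinitePi_infinitePi_of_inj (P := fun _ : ℤ => siteMeasure V β)
    (add_left_injective j)

lemma Admissible.measurePreserving_update (h : Admissible V δm δp β) (i : ℤ) :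
    MeasurePreserving (fun z : Conf × (ℝ × ℝ) => Function.update z.1 i z.2)
      ((gibbs V β).prod (siteMeasure V β)) (gibbs V β) := by
  have := h.isProbabilityMeasure_site
  have := h.isProbabilityMeasure_gibbs
  have hm : Measurable fun z : Conf × (ℝ × ℝ) => Function.update z.1 i z.2 := by
    rw [measurable_pi_iff]
    intro k
    by_cases hk : k = i
    · subst hk
      simpa using measurable_snd
    · simp only [Function.update_of_ne hk]
      fun_prop
  refine ⟨hm, ?_⟩
  refine Measure.eq_infinitePi _ fun s t ht => ?_
  rw [Measure.map_apply hm (.pi s.countable_toSet fun _ _ => ht _)]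
  classical
  have e : (fun z : Conf × (ℝ × ℝ) => Function.update z.1 i z.2) ⁻¹' ((s : Set ℤ).pi t)
      = (((s.erase i : Finset ℤ) : Set ℤ).pi t) ×ˢ (if i ∈ s then t i else Set.univ) := by
    ext z
    simp only [Set.mem_preimage, Set.mem_pi, Set.mem_prod, Finset.mem_coe, Finset.mem_erase]
    constructor
    · intro hz
      refine ⟨fun k hk => by simpa [Function.update_of_ne hk.1] using hz k hk.2, ?_⟩
      split_ifs with his
      · simpa using hz i his
      · trivial
    · rintro ⟨h1, h2⟩ k hk
      by_cases hki : k = i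
      · subst hki
        simpa [hk] using h2
      · simpa [Function.update_of_ne hki] using h1 k ⟨hki, hk⟩
  rw [e, Measure.prod_prod, gibbs, Measure.infinitePi_pi _ fun i _ => ht i]
  split_ifs with his
  · rw [Finset.prod_erase_mul _ _ his]
  · rw [measure_univ, mul_one, Finset.erase_eq_of_notMem his]

lemma Admissible.avg_shift (h : Admissible V δm δp β) (j : ℤ) (f : Conf → ℝ) :
    avg V β (shift j f) = avg V β f := by
  have e : MeasurableEmbedding (fun (ω : Conf) i => ω (i + j)) := by
    convert (MeasurableEquiv.piCongrLeft (fun _ : ℤ => ℝ × ℝ)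
      (Equiv.subRight j)).measurableEmbedding using 1
    ext ω i
    all_goals simp [MeasurableEquiv.coe_piCongrLeft, Equiv.piCongrLeft_apply]
  exact (h.measurePreserving_shift j).integral_comp e f

/-- Integration by parts in the coordinates of one site. -/
lemma Admissible.avg_lineDeriv (h : Admissible V δm δp β) (i : ℤ) {v : ℝ × ℝ}
    {f f' : Conf → ℝ}
    (hf : ∀ ω x, HasLineDerivAt ℝ (fun x => f (Function.update ω i x))
      (f' (Function.update ω i x)) x v)
    (hi : Integrable f (gibbs V β)) (hi' : Integrable f' (gibbs V β))
    (hi'' : Integrable (fun ω => (v.1 * (ω i).1 + v.2 * deriv V (ω i).2) * f ω) (gibbs V β)) :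
    avg V β f' = β * avg V β fun ω => (v.1 * (ω i).1 + v.2 * deriv V (ω i).2) * f ω := by
  have := h.isProbabilityMeasure_site
  have := h.isProbabilityMeasure_gibbs
  have hu := h.measurePreserving_update i
  have fub : ∀ g : Conf → ℝ, Integrable g (gibbs V β) →
      avg V β g = ∫ ω, ∫ x, g (Function.update ω i x) ∂siteMeasure V β ∂gibbs V β := by
    intro g hg
    rw [avg, ← hu.map_eq, integral_map hu.measurable.aemeasurable (by
      rw [hu.map_eq]; exact hg.aestronglyMeasurable), hu.map_eq]
    exact integral_prod _ (hu.integrable_comp_of_integrable hg)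
  have sl : ∀ g : Conf → ℝ, Integrable g (gibbs V β) →
      ∀ᵐ ω ∂gibbs V β, Integrable (fun x => g (Function.update ω i x)) (siteMeasure V β) :=
    fun g hg => (hu.integrable_comp_of_integrable hg).prod_right_ae
  rw [fub f' hi', fub _ hi'', ← integral_const_mul]
  refine integral_congr_ae ?_
  filter_upwards [sl f hi, sl f' hi', sl _ hi''] with ω h1 h2 h3
  simp only [Function.update_self] at h3 ⊢
  exact h.site_integral_lineDeriv (hf ω) h1 h2 h3

end Gibbs

section AllLp

variable {V : ℝ → ℝ} {δm δp β : ℝ} {f g : Conf → ℝ}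

/-- Membership in every `L^k(ν_β)` with `k` finite. -/
def AllLp (V : ℝ → ℝ) (β : ℝ) (f : Conf → ℝ) : Prop := ∀ k : ℕ, MemLp f k (gibbs V β)

lemma AllLp.integrable (hf : AllLp V β f) : Integrable f (gibbs V β) :=
  memLp_one_iff_integrable.1 (by simpa using hf 1)

lemma AllLp.aestronglyMeasurable (hf : AllLp V β f) : AEStronglyMeasurable f (gibbs V β) :=
  (hf 1).aestronglyMeasurable

lemma AllLp.add (hf : AllLp V β f) (hg : AllLp V β g) : AllLp V β fun ω => f ω + g ω :=
  fun k => (hf k).add (hg k)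

lemma AllLp.sub (hf : AllLp V β f) (hg : AllLp V β g) : AllLp V β fun ω => f ω - g ω :=
  fun k => (hf k).sub (hg k)

lemma AllLp.const_mul (hf : AllLp V β f) (c : ℝ) : AllLp V β fun ω => c * f ω :=
  fun k => (hf k).const_mul c

lemma AllLp.neg (hf : AllLp V β f) : AllLp V β fun ω => -f ω :=
  fun k => (hf k).neg

lemma AllLp.mul (hf : AllLp V β f) (hg : AllLp V β g) : AllLp V β fun ω => f ω * g ω := by
  intro k
  have : ENNReal.HolderTriple ((2 * k : ℕ) : ENNReal) ((2 * k : ℕ) : ENNReal) (k : ENNReal) := by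
    constructor
    push_cast
    rw [ENNReal.mul_inv (by simp) (by simp), ← add_mul, ENNReal.inv_two_add_inv_two, one_mul]
  exact (hg (2 * k)).mul (hf (2 * k))

lemma Admissible.allLp_const (h : Admissible V δm δp β) (c : ℝ) : AllLp V β fun _ => c := by
  have := h.isProbabilityMeasure_gibbs
  exact fun k => memLp_const c

lemma AllLp.mono (hg : AllLp V β g) (hm : AEStronglyMeasurable f (gibbs V β))
    (hfg : ∀ ω, |f ω| ≤ g ω) : AllLp V β f :=
  fun k => (hg k).mono' hm (Filter.Eventually.of_forall hfg)

lemma AllLp.abs (hf : AllLp V β f) : AllLp V β fun ω => |f ω| := fun k => (hf k).abs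

lemma Admissible.allLp_shift (h : Admissible V δm δp β) (hf : AllLp V β f) (j : ℤ) :
    AllLp V β (shift j f) :=
  fun k => (hf k).comp_measurePreserving (h.measurePreserving_shift j)

lemma Admissible.allLp_eval (h : Admissible V δm δp β) (i : ℤ) {φ : ℝ × ℝ → ℝ}
    (hm : AEStronglyMeasurable φ (siteMeasure V β))
    (hφ : ∀ k : ℕ, Integrable (fun x => |φ x| ^ k) (siteMeasure V β)) :
    AllLp V β fun ω => φ (ω i) := by
  have := h.isProbabilityMeasure_site
  have := h.isProbabilityMeasure_gibbs
  intro k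
  have h1 : MemLp φ k (siteMeasure V β) := by
    rcases eq_or_ne k 0 with rfl | hk
    · simpa using hm
    · refine (integrable_norm_rpow_iff hm (by simpa using hk) (by simp)).1 ?_
      simpa using hφ k
  exact h1.comp_measurePreserving
    (measurePreserving_eval_infinitePi (fun _ : ℤ => siteMeasure V β) i)

lemma Admissible.allLp_p (h : Admissible V δm δp β) (i : ℤ) : AllLp V β fun ω => (ω i).1 :=
  h.allLp_eval i (φ := Prod.fst) measurable_fst.aestronglyMeasurable
    fun k => by simpa using h.integrable_site_pow k 0

lemma Admissible.allLp_r (h : Admissible V δm δp β) (i : ℤ) : AllLp V β fun ω => (ω i).2 :=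
  h.allLp_eval i (φ := Prod.snd) measurable_snd.aestronglyMeasurable
    fun k => by simpa using h.integrable_site_pow 0 k

lemma aestronglyMeasurable_of_continuous (hf : Continuous f) :
    AEStronglyMeasurable f (gibbs V β) :=
  hf.measurable.aestronglyMeasurable

lemma Admissible.allLp_V (h : Admissible V δm δp β) (i : ℤ) : AllLp V β fun ω => V (ω i).2 := by
  have hc := h.differentiable.continuous
  refine ((h.allLp_const (V 0)).add ((h.allLp_r i).mul (h.allLp_r i) |>.const_mul δp)).mono
    (aestronglyMeasurable_of_continuous (by fun_prop)) fun ω => ?_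
  rw [abs_of_nonneg (h.nonneg _)]
  simpa [sq] using h.le_mul_sq (ω i).2

lemma Admissible.allLp_V' (h : Admissible V δm δp β) (i : ℤ) :
    AllLp V β fun ω => deriv V (ω i).2 := by
  have hc := h.continuous_deriv
  exact ((h.allLp_r i).abs.const_mul δp).mono
    (aestronglyMeasurable_of_continuous (by fun_prop)) fun ω => h.abs_deriv_le _

lemma Admissible.allLp_V'' (h : Admissible V δm δp β) (i : ℤ) :
    AllLp V β fun ω => deriv (deriv V) (ω i).2 := by
  have hc := h.continuous_deriv_deriv
  exact (h.allLp_const δp).mono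
    (aestronglyMeasurable_of_continuous (by fun_prop)) fun ω => h.abs_deriv_deriv_le _

end AllLp

section Tame

variable {V : ℝ → ℝ} {δm δp β : ℝ} {f g : Conf → ℝ}

/-- Functions differentiable in each coordinate which, together with their first partial
derivatives, belong to every `L^k(ν_β)`. -/
structure Tame (V : ℝ → ℝ) (β : ℝ) (f : Conf → ℝ) : Prop where
  allLp : AllLp V β f
  allLp_dP : ∀ i, AllLp V β (dP i f)
  allLp_dR : ∀ i, AllLp V β (dR i f)
  diffP : ∀ i ω, Differentiable ℝ fun x : ℝ => f (Function.update ω i (x, (ω i).2))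
  diffR : ∀ i ω, Differentiable ℝ fun x : ℝ => f (Function.update ω i ((ω i).1, x))

lemma Tame.dP_add (hf : Tame V β f) (hg : Tame V β g) (i : ℤ) :
    dP i (fun ω => f ω + g ω) = fun ω => dP i f ω + dP i g ω :=
  funext fun ω => deriv_fun_add (hf.diffP i ω _) (hg.diffP i ω _)

lemma Tame.dR_add (hf : Tame V β f) (hg : Tame V β g) (i : ℤ) :
    dR i (fun ω => f ω + g ω) = fun ω => dR i f ω + dR i g ω :=
  funext fun ω => deriv_fun_add (hf.diffR i ω _) (hg.diffR i ω _)

lemma Tame.dP_mul (hf : Tame V β f) (hg : Tame V β g) (i : ℤ) :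
    dP i (fun ω => f ω * g ω) = fun ω => dP i f ω * g ω + f ω * dP i g ω := by
  funext ω
  have := deriv_fun_mul (hf.diffP i ω (ω i).1) (hg.diffP i ω (ω i).1)
  simpa [dP] using this

lemma Tame.dR_mul (hf : Tame V β f) (hg : Tame V β g) (i : ℤ) :
    dR i (fun ω => f ω * g ω) = fun ω => dR i f ω * g ω + f ω * dR i g ω := by
  funext ω
  have := deriv_fun_mul (hf.diffR i ω (ω i).2) (hg.diffR i ω (ω i).2)
  simpa [dR] using this

lemma dP_const (c : ℝ) (i : ℤ) : dP i (fun _ => c) = fun _ => 0 :=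
  funext fun _ => deriv_const _ _

lemma dR_const (c : ℝ) (i : ℤ) : dR i (fun _ => c) = fun _ => 0 :=
  funext fun _ => deriv_const _ _

lemma Tame.add (hf : Tame V β f) (hg : Tame V β g) : Tame V β fun ω => f ω + g ω where
  allLp := hf.allLp.add hg.allLp
  allLp_dP i := by
    rw [hf.dP_add hg]
    exact (hf.allLp_dP i).add (hg.allLp_dP i)
  allLp_dR i := by
    rw [hf.dR_add hg]
    exact (hf.allLp_dR i).add (hg.allLp_dR i)
  diffP i ω := (hf.diffP i ω).add (hg.diffP i ω)
  diffR i ω := (hf.diffR i ω).add (hg.diffR i ω)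

lemma Tame.mul (hf : Tame V β f) (hg : Tame V β g) : Tame V β fun ω => f ω * g ω where
  allLp := hf.allLp.mul hg.allLp
  allLp_dP i := by
    rw [hf.dP_mul hg]
    exact ((hf.allLp_dP i).mul hg.allLp).add (hf.allLp.mul (hg.allLp_dP i))
  allLp_dR i := by
    rw [hf.dR_mul hg]
    exact ((hf.allLp_dR i).mul hg.allLp).add (hf.allLp.mul (hg.allLp_dR i))
  diffP i ω := (hf.diffP i ω).mul (hg.diffP i ω)
  diffR i ω := (hf.diffR i ω).mul (hg.diffR i ω)

lemma Admissible.tame_const (h : Admissible V δm δp β) (c : ℝ) : Tame V β fun _ => c where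
  allLp := h.allLp_const c
  allLp_dP i := by
    rw [dP_const]
    exact h.allLp_const 0
  allLp_dR i := by
    rw [dR_const]
    exact h.allLp_const 0
  diffP _ _ := differentiable_const c
  diffR _ _ := differentiable_const c

lemma Admissible.tame_const_mul (h : Admissible V δm δp β) (hf : Tame V β f) (c : ℝ) :
    Tame V β fun ω => c * f ω :=
  (h.tame_const c).mul hf

lemma Admissible.tame_sub (h : Admissible V δm δp β) (hf : Tame V β f) (hg : Tame V β g) :
    Tame V β fun ω => f ω - g ω := by
  simpa [sub_eq_add_neg] using hf.add (h.tame_const_mul hg (-1))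

lemma Admissible.tame_sum (h : Admissible V δm δp β) {ι : Type*} (s : Finset ι)
    {F : ι → Conf → ℝ} (hF : ∀ i ∈ s, Tame V β (F i)) : Tame V β fun ω => ∑ i ∈ s, F i ω := by
  classical
  induction s using Finset.induction_on with
  | empty => simpa using h.tame_const 0
  | insert a s ha ih =>
    simp only [Finset.sum_insert ha]
    exact (hF a (by simp)).add (ih fun i hi => hF i (by simp [hi]))

lemma shift_update (j i : ℤ) (ω : Conf) (x : ℝ × ℝ) :
    (fun k => Function.update ω i x (k + j)) = Function.update (fun k => ω (k + j)) (i - j) x := by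
  funext k
  by_cases hk : k = i - j
  · subst hk
    simp
  · rw [Function.update_of_ne hk, Function.update_of_ne (by lia)]

lemma dP_shift (i j : ℤ) (f : Conf → ℝ) : dP i (shift j f) = shift j (dP (i - j) f) := by
  funext ω
  simp [dP, shift, shift_update]

lemma dR_shift (i j : ℤ) (f : Conf → ℝ) : dR i (shift j f) = shift j (dR (i - j) f) := by
  funext ω
  simp [dR, shift, shift_update]

lemma Admissible.tame_shift (h : Admissible V δm δp β) (hf : Tame V β f) (j : ℤ) :
    Tame V β (shift j f) where
  allLp := h.allLp_shift hf.allLp j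
  allLp_dP i := by
    rw [dP_shift]
    exact h.allLp_shift (hf.allLp_dP _) j
  allLp_dR i := by
    rw [dR_shift]
    exact h.allLp_shift (hf.allLp_dR _) j
  diffP i ω := by
    simpa [shift, shift_update] using hf.diffP (i - j) fun k => ω (k + j)
  diffR i ω := by
    simpa [shift, shift_update] using hf.diffR (i - j) fun k => ω (k + j)

lemma dP_comp_p (φ : ℝ → ℝ) (i j : ℤ) :
    dP j (fun ω => φ (ω i).1) = fun ω => if i = j then deriv φ (ω i).1 else 0 := by
  funext ω
  by_cases hij : i = j
  · subst hij
    simp [dP]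
  · simp [dP, hij]

lemma dP_comp_r (φ : ℝ → ℝ) (i j : ℤ) : dP j (fun ω => φ (ω i).2) = fun _ => 0 := by
  funext ω
  by_cases hij : i = j
  · subst hij
    simp [dP]
  · simp [dP, hij]

lemma dR_comp_p (φ : ℝ → ℝ) (i j : ℤ) : dR j (fun ω => φ (ω i).1) = fun _ => 0 := by
  funext ω
  by_cases hij : i = j
  · subst hij
    simp [dR]
  · simp [dR, hij]

lemma dR_comp_r (φ : ℝ → ℝ) (i j : ℤ) :
    dR j (fun ω => φ (ω i).2) = fun ω => if i = j then deriv φ (ω i).2 else 0 := by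
  funext ω
  by_cases hij : i = j
  · subst hij
    simp [dR]
  · simp [dR, hij]

lemma Admissible.tame_comp_r (h : Admissible V δm δp β) {φ : ℝ → ℝ} (hφ : Differentiable ℝ φ)
    (i : ℤ) (h1 : AllLp V β fun ω => φ (ω i).2) (h2 : AllLp V β fun ω => deriv φ (ω i).2) :
    Tame V β fun ω => φ (ω i).2 where
  allLp := h1
  allLp_dP j := by
    rw [dP_comp_r]
    exact h.allLp_const 0
  allLp_dR j := by
    rw [dR_comp_r]
    by_cases hij : i = j
    · simpa [hij] using hij ▸ h2
    · simpa [hij] using h.allLp_const 0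
  diffP j ω := by
    by_cases hij : i = j
    · subst hij
      simp
    · simp [hij]
  diffR j ω := by
    by_cases hij : i = j
    · subst hij
      simpa using hφ
    · simp [hij]

lemma Admissible.tame_p (h : Admissible V δm δp β) (i : ℤ) : Tame V β fun ω => (ω i).1 where
  allLp := h.allLp_p i
  allLp_dP j := by
    rw [dP_comp_p fun x => x]
    by_cases hij : i = j
    · simpa [hij] using h.allLp_const 1
    · simpa [hij] using h.allLp_const 0
  allLp_dR j := by
    rw [dR_comp_p fun x => x]
    exact h.allLp_const 0
  diffP j ω := by
    by_cases hij : i = j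
    · subst hij
      simp
    · simp [hij]
  diffR j ω := by
    by_cases hij : i = j
    · subst hij
      simp
    · simp [hij]

lemma Admissible.tame_V (h : Admissible V δm δp β) (i : ℤ) : Tame V β fun ω => V (ω i).2 :=
  h.tame_comp_r h.differentiable i (h.allLp_V i) (h.allLp_V' i)

lemma Admissible.tame_V' (h : Admissible V δm δp β) (i : ℤ) :
    Tame V β fun ω => deriv V (ω i).2 :=
  h.tame_comp_r h.differentiable_deriv i (h.allLp_V' i) (h.allLp_V'' i)

lemma Admissible.tame_p_sq (h : Admissible V δm δp β) (i : ℤ) :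
    Tame V β fun ω => (ω i).1 ^ 2 := by
  simpa [sq] using (h.tame_p i).mul (h.tame_p i)

lemma Admissible.tame_half_p_sq (h : Admissible V δm δp β) (i : ℤ) :
    Tame V β fun ω => (ω i).1 ^ 2 / 2 := by
  simpa [div_eq_inv_mul] using h.tame_const_mul (h.tame_p_sq i) (2⁻¹)

lemma Admissible.tame_energy (h : Admissible V δm δp β) (i : ℤ) : Tame V β (energy V i) :=
  (h.tame_half_p_sq i).add (h.tame_V i)

/-! ### Integration by parts -/

lemma Admissible.avg_dP (h : Admissible V δm δp β) (hf : Tame V β f) (i : ℤ) :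
    avg V β (dP i f) = β * avg V β fun ω => (ω i).1 * f ω := by
  have key := h.avg_lineDeriv i (v := (1, 0)) (f := f) (f' := dP i f) (fun ω x => ?_)
    hf.allLp.integrable (hf.allLp_dP i).integrable
    (by simpa using ((h.allLp_p i).mul hf.allLp).integrable)
  · simpa using key
  · have h1 := ((hf.diffP i (Function.update ω i x)) x.1).hasDerivAt
    have h2 : HasDerivAt (fun t : ℝ => x.1 + t) 1 0 := (hasDerivAt_id _).const_add _
    rw [← add_zero x.1] at h1
    have h3 := h1.comp (0 : ℝ) h2
    simpa [HasLineDerivAt, dP, Function.comp_def, Prod.add_def] using h3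

lemma Admissible.avg_dR (h : Admissible V δm δp β) (hf : Tame V β f) (i : ℤ) :
    avg V β (dR i f) = β * avg V β fun ω => deriv V (ω i).2 * f ω := by
  have key := h.avg_lineDeriv i (v := (0, 1)) (f := f) (f' := dR i f) (fun ω x => ?_)
    hf.allLp.integrable (hf.allLp_dR i).integrable
    (by simpa using ((h.allLp_V' i).mul hf.allLp).integrable)
  · simpa using key
  · have h1 := ((hf.diffR i (Function.update ω i x)) x.2).hasDerivAt
    have h2 : HasDerivAt (fun t : ℝ => x.2 + t) 1 0 := (hasDerivAt_id _).const_add _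
    rw [← add_zero x.2] at h1
    have h3 := h1.comp (0 : ℝ) h2
    simpa [HasLineDerivAt, dR, Function.comp_def, Prod.add_def] using h3

lemma Tame.opY_add (hf : Tame V β f) (hg : Tame V β g) (i j : ℤ) :
    opY V i j (fun ω => f ω + g ω) = fun ω => opY V i j f ω + opY V i j g ω := by
  funext ω
  simp only [opY, hf.dP_add hg, hf.dR_add hg]
  ring

lemma Tame.opY_mul (hf : Tame V β f) (hg : Tame V β g) (i j : ℤ) :
    opY V i j (fun ω => f ω * g ω) = fun ω => opY V i j f ω * g ω + f ω * opY V i j g ω := by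
  funext ω
  simp only [opY, hf.dP_mul hg, hf.dR_mul hg]
  ring

lemma opY_const (c : ℝ) (i j : ℤ) : opY V i j (fun _ => c) = fun _ => 0 := by
  funext ω
  simp [opY, dP_const, dR_const]

lemma Admissible.opY_const_mul (h : Admissible V δm δp β) (hf : Tame V β f) (c : ℝ) (i j : ℤ) :
    opY V i j (fun ω => c * f ω) = fun ω => c * opY V i j f ω := by
  rw [(h.tame_const c).opY_mul hf]
  simp [opY_const]

lemma Admissible.opY_sum (h : Admissible V δm δp β) {ι : Type*} (s : Finset ι)
    {F : ι → Conf → ℝ} (hF : ∀ i ∈ s, Tame V β (F i)) (i j : ℤ) :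
    opY V i j (fun ω => ∑ a ∈ s, F a ω) = fun ω => ∑ a ∈ s, opY V i j (F a) ω := by
  classical
  induction s using Finset.induction_on with
  | empty => simp [opY_const]
  | insert a s ha ih =>
    simp only [Finset.sum_insert ha]
    rw [(hF a (by simp)).opY_add (h.tame_sum s fun i hi => hF i (by simp [hi])),
      ih fun i hi => hF i (by simp [hi])]

lemma opY_shift (i j k : ℤ) (f : Conf → ℝ) :
    opY V i j (shift k f) = shift k (opY V (i - k) (j - k) f) := by
  funext ω
  simp [opY, dP_shift, dR_shift, shift]

lemma Admissible.allLp_opY (h : Admissible V δm δp β) (hf : Tame V β f) (i j : ℤ) :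
    AllLp V β (opY V i j f) :=
  ((h.allLp_p i).mul (hf.allLp_dR j)).sub ((h.allLp_V' j).mul (hf.allLp_dP i))

lemma avg_sub (hf : AllLp V β f) (hg : AllLp V β g) :
    avg V β (fun ω => f ω - g ω) = avg V β f - avg V β g :=
  integral_sub hf.integrable hg.integrable

lemma avg_add (hf : AllLp V β f) (hg : AllLp V β g) :
    avg V β (fun ω => f ω + g ω) = avg V β f + avg V β g :=
  integral_add hf.integrable hg.integrable

lemma avg_const_mul (c : ℝ) (f : Conf → ℝ) : avg V β (fun ω => c * f ω) = c * avg V β f :=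
  integral_const_mul c f

lemma avg_neg (f : Conf → ℝ) : avg V β (fun ω => -f ω) = -avg V β f :=
  integral_neg f

lemma avg_sum {ι : Type*} (s : Finset ι) {F : ι → Conf → ℝ} (hF : ∀ i ∈ s, AllLp V β (F i)) :
    avg V β (fun ω => ∑ i ∈ s, F i ω) = ∑ i ∈ s, avg V β (F i) :=
  integral_finsetSum s fun i hi => (hF i hi).integrable

lemma Admissible.avg_const (h : Admissible V δm δp β) (c : ℝ) : avg V β (fun _ => c) = c := by
  have := h.isProbabilityMeasure_gibbs
  simp [avg]

lemma Admissible.avg_opY (h : Admissible V δm δp β) (hf : Tame V β f) (i j : ℤ) :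
    avg V β (opY V i j f) = 0 := by
  have h1 : dR j (fun ω => (ω i).1 * f ω) = fun ω => (ω i).1 * dR j f ω := by
    rw [(h.tame_p i).dR_mul hf, dR_comp_p fun x => x]
    simp
  have h2 : dP i (fun ω => deriv V (ω j).2 * f ω) = fun ω => deriv V (ω j).2 * dP i f ω := by
    rw [(h.tame_V' j).dP_mul hf, dP_comp_r]
    simp
  have e1 := h.avg_dR ((h.tame_p i).mul hf) j
  have e2 := h.avg_dP ((h.tame_V' j).mul hf) i
  rw [h1] at e1
  rw [h2] at e2
  unfold opY
  rw [avg_sub ((h.allLp_p i).mul (hf.allLp_dR j)) ((h.allLp_V' j).mul (hf.allLp_dP i)), e1, e2,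
    ← mul_sub, sub_eq_zero.2, mul_zero]
  congr 1
  funext ω
  ring

/-- The fields `Y_{i,j}` are antisymmetric in `L²(ν_β)`. -/
lemma Admissible.avg_mul_opY (h : Admissible V δm δp β) (hf : Tame V β f) (hg : Tame V β g)
    (i j : ℤ) :
    avg V β (fun ω => f ω * opY V i j g ω) = -avg V β (fun ω => opY V i j f ω * g ω) := by
  have e := h.avg_opY (hf.mul hg) i j
  rw [hf.opY_mul hg, avg_add ((h.allLp_opY hf i j).mul hg.allLp)
    (hf.allLp.mul (h.allLp_opY hg i j))] at e
  linarith

end Tame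

section Local

variable {V : ℝ → ℝ} {f : Conf → ℝ} {s : Set ℤ}

lemma apply_update_of_dependsOn (hf : DependsOn f s) {i : ℤ} (hi : i ∉ s) (ω : Conf)
    (x : ℝ × ℝ) : f (Function.update ω i x) = f ω :=
  hf fun _ hk => Function.update_of_ne (ne_of_mem_of_not_mem hk hi) _ _

lemma dP_eq_zero_of_dependsOn (hf : DependsOn f s) {i : ℤ} (hi : i ∉ s) :
    dP i f = fun _ => 0 := by
  funext ω
  simp [dP, apply_update_of_dependsOn hf hi]

lemma dR_eq_zero_of_dependsOn (hf : DependsOn f s) {i : ℤ} (hi : i ∉ s) :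
    dR i f = fun _ => 0 := by
  funext ω
  simp [dR, apply_update_of_dependsOn hf hi]

lemma opY_eq_zero_of_dependsOn (hf : DependsOn f s) {i j : ℤ} (hi : i ∉ s) (hj : j ∉ s) :
    opY V i j f = fun _ => 0 := by
  funext ω
  simp [opY, dP_eq_zero_of_dependsOn hf hi, dR_eq_zero_of_dependsOn hf hj]

end Local

section Test

variable {V : ℝ → ℝ} {δm δp β : ℝ} {f : Conf → ℝ}

/-- Smooth local functions with compact support in the coordinates of `Λ`. -/
def IsTest (Λ : Finset ℤ) (f : Conf → ℝ) : Prop :=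
  ∃ φ : (Λ → ℝ × ℝ) → ℝ, ContDiff ℝ ((⊤ : ℕ∞) : WithTop ℕ∞) φ ∧ HasCompactSupport φ ∧
    ∀ ω : Conf, f ω = φ fun i => ω i

lemma hasDerivAt_comp_restrict_update {Λ : Finset ℤ} {φ : (Λ → ℝ × ℝ) → ℝ}
    (hφ : Differentiable ℝ φ) {i : ℤ} {ω : Conf} {c : ℝ → ℝ × ℝ} {v : ℝ × ℝ} {t : ℝ}
    (hc : HasDerivAt c v t) :
    HasDerivAt (fun x => φ fun k : Λ => Function.update ω i (c x) k)
      (fderiv ℝ φ (fun k : Λ => Function.update ω i (c t) k)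
        fun k : Λ => if (k : ℤ) = i then v else 0) t := by
  refine (hφ _).hasFDerivAt.comp_hasDerivAt t (hasDerivAt_pi.2 fun k => ?_)
  by_cases hk : (k : ℤ) = i
  · subst hk
    simpa using hc
  · simpa [hk] using hasDerivAt_const t (ω k)

lemma IsTest.fderiv_apply {Λ : Finset ℤ} {φ : (Λ → ℝ × ℝ) → ℝ}
    (h1 : ContDiff ℝ ((⊤ : ℕ∞) : WithTop ℕ∞) φ) (h2 : HasCompactSupport φ) (v : Λ → ℝ × ℝ) :
    IsTest Λ fun ω => fderiv ℝ φ (fun k : Λ => ω k) v :=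
  ⟨fun x => fderiv ℝ φ x v, (contDiff_infty_iff_fderiv.1 h1).2.clm_apply contDiff_const,
    h2.fderiv_apply (𝕜 := ℝ) v, fun _ => rfl⟩

lemma IsTest.dP {Λ : Finset ℤ} (hf : IsTest Λ f) (i : ℤ) : IsTest Λ (dP i f) := by
  obtain ⟨φ, h1, h2, h3⟩ := hf
  convert IsTest.fderiv_apply h1 h2 (fun k : Λ => if (k : ℤ) = i then (1, 0) else 0) using 1
  funext ω
  have := (hasDerivAt_comp_restrict_update (h1.differentiable (by simp)) (ω := ω) (i := i)
    (c := fun x => (x, (ω i).2))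
    ((hasDerivAt_id (ω i).1).prodMk (hasDerivAt_const _ _))).deriv
  simpa [AnharmonicChain.dP, h3] using this

lemma IsTest.dR {Λ : Finset ℤ} (hf : IsTest Λ f) (i : ℤ) : IsTest Λ (dR i f) := by
  obtain ⟨φ, h1, h2, h3⟩ := hf
  convert IsTest.fderiv_apply h1 h2 (fun k : Λ => if (k : ℤ) = i then (0, 1) else 0) using 1
  funext ω
  have := (hasDerivAt_comp_restrict_update (h1.differentiable (by simp)) (ω := ω) (i := i)
    (c := fun x => ((ω i).1, x))
    ((hasDerivAt_const _ _).prodMk (hasDerivAt_id (ω i).2))).deriv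
  simpa [AnharmonicChain.dR, h3] using this

lemma IsTest.continuous {Λ : Finset ℤ} (hf : IsTest Λ f) : Continuous f := by
  obtain ⟨φ, h1, h2, h3⟩ := hf
  rw [funext h3]
  exact h1.continuous.comp (by fun_prop)

lemma Admissible.allLp_of_isTest (h : Admissible V δm δp β) {Λ : Finset ℤ} (hf : IsTest Λ f) :
    AllLp V β f := by
  have hc := hf.continuous
  obtain ⟨φ, h1, h2, h3⟩ := hf
  obtain ⟨C, hC⟩ := h2.exists_bound_of_continuous h1.continuous
  exact (h.allLp_const C).mono (aestronglyMeasurable_of_continuous hc)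
    fun ω => by rw [h3]; exact hC _

lemma Admissible.tame_of_isTest (h : Admissible V δm δp β) {Λ : Finset ℤ} (hf : IsTest Λ f) :
    Tame V β f where
  allLp := h.allLp_of_isTest hf
  allLp_dP i := h.allLp_of_isTest (hf.dP i)
  allLp_dR i := h.allLp_of_isTest (hf.dR i)
  diffP i ω := by
    obtain ⟨φ, h1, h2, h3⟩ := hf
    intro x
    have := (hasDerivAt_comp_restrict_update (h1.differentiable (by simp)) (ω := ω) (i := i)
      (c := fun x => (x, (ω i).2))
      ((hasDerivAt_id x).prodMk (hasDerivAt_const _ _))).differentiableAt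
    simpa [h3] using this
  diffR i ω := by
    obtain ⟨φ, h1, h2, h3⟩ := hf
    intro x
    have := (hasDerivAt_comp_restrict_update (h1.differentiable (by simp)) (ω := ω) (i := i)
      (c := fun x => ((ω i).1, x))
      ((hasDerivAt_const _ _).prodMk (hasDerivAt_id x))).differentiableAt
    simpa [h3] using this

lemma IsTest.dependsOn {Λ : Finset ℤ} (hf : IsTest Λ f) : DependsOn f (Λ : Set ℤ) := by
  obtain ⟨φ, -, -, h3⟩ := hf
  intro ω ω' hω
  rw [h3, h3]
  congr 1
  funext i
  exact hω i i.2

lemma Admissible.tame_opY_of_isTest (h : Admissible V δm δp β) {Λ : Finset ℤ}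
    (hf : IsTest Λ f) (i j : ℤ) : Tame V β (opY V i j f) :=
  h.tame_sub ((h.tame_p i).mul (h.tame_of_isTest (hf.dR j)))
    ((h.tame_V' j).mul (h.tame_of_isTest (hf.dP i)))

end Test

section Gradient

variable {V : ℝ → ℝ} {δm δp β : ℝ} {f g : Conf → ℝ} {Λ : Finset ℤ}

/-- The sites `k` such that `k` or `k + 1` belongs to `Λ`. -/
def bondSupport (Λ : Finset ℤ) : Finset ℤ := Λ ∪ Λ.image fun k => k - 1

lemma notMem_of_notMem_bondSupport {k e : ℤ} (he : e = 0 ∨ e = 1) (hk : k ∉ bondSupport Λ) :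
    k ∉ Λ ∧ k + e ∉ Λ := by
  simp only [bondSupport, Finset.mem_union, Finset.mem_image, not_or, not_exists, not_and] at hk
  refine ⟨hk.1, ?_⟩
  rcases he with rfl | rfl
  · simpa using hk.1
  · exact fun h => hk.2 _ h (by ring)

lemma opY_eq_zero_of_notMem_bondSupport (hf : DependsOn f (Λ : Set ℤ)) {k e : ℤ}
    (he : e = 0 ∨ e = 1) (hk : k ∉ bondSupport Λ) : opY V k (k + e) f = fun _ => 0 :=
  opY_eq_zero_of_dependsOn hf (by simpa using (notMem_of_notMem_bondSupport he hk).1)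
    (by exact_mod_cast (notMem_of_notMem_bondSupport he hk).2)

/-- `Y_{0,e} Γ_g`; this is `XGamma` for `e = 0` and `YGamma` for `e = 1`. -/
def gradGamma (V : ℝ → ℝ) (e : ℤ) (g : Conf → ℝ) : Conf → ℝ := fun ω =>
  ∑ᶠ j : ℤ, opY V 0 e (shift j g) ω

lemma XGamma_eq_gradGamma : XGamma V g = gradGamma V 0 g := rfl

lemma YGamma_eq_gradGamma : YGamma V g = gradGamma V 1 g := rfl

lemma shift_shift (i j : ℤ) (f : Conf → ℝ) : shift i (shift j f) = shift (i + j) f := by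
  funext ω
  simp only [shift]
  congr 1
  funext k
  congr 1
  ring

lemma shift_zero (f : Conf → ℝ) : shift 0 f = f := by
  funext ω
  simp [shift]

lemma shift_const (j : ℤ) (c : ℝ) : shift j (fun _ => c) = fun _ => c := rfl

lemma gradGamma_eq_sum (hg : DependsOn g (Λ : Set ℤ)) {e : ℤ} (he : e = 0 ∨ e = 1) :
    gradGamma V e g = fun ω => ∑ k ∈ bondSupport Λ, opY V 0 e (shift (-k) g) ω := by
  funext ω
  have h1 : gradGamma V e g ω = ∑ᶠ k : ℤ, opY V 0 e (shift (-k) g) ω :=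
    (finsum_comp_equiv (Equiv.neg ℤ)).symm
  rw [h1]
  refine finsum_eq_sum_of_support_subset _ fun k hk => ?_
  by_contra hk'
  apply hk
  have := opY_eq_zero_of_notMem_bondSupport (V := V) hg he hk'
  simp only
  rw [opY_shift, show (0 : ℤ) - -k = k by ring, show e - -k = k + e by ring, this, shift_const]

/-- The part `∑_{k ∈ K} τ_{-k} f` of the formal sum `Γ_f`. -/
def partialGamma (K : Finset ℤ) (f : Conf → ℝ) : Conf → ℝ := fun ω => ∑ k ∈ K, shift (-k) f ω

lemma Admissible.tame_partialGamma (h : Admissible V δm δp β) (K : Finset ℤ)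
    (hf : Tame V β f) : Tame V β (partialGamma K f) :=
  h.tame_sum K fun k _ => h.tame_shift hf (-k)

lemma Admissible.gradGamma_eq_opY (h : Admissible V δm δp β) (hg : DependsOn g (Λ : Set ℤ))
    (ht : Tame V β g) {e : ℤ} (he : e = 0 ∨ e = 1) :
    gradGamma V e g = opY V 0 e (partialGamma (bondSupport Λ) g) := by
  unfold partialGamma
  rw [gradGamma_eq_sum hg he, h.opY_sum _ fun k _ => h.tame_shift ht (-k)]

lemma Admissible.allLp_gradGamma (h : Admissible V δm δp β) (hg : DependsOn g (Λ : Set ℤ))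
    (ht : Tame V β g) {e : ℤ} (he : e = 0 ∨ e = 1) : AllLp V β (gradGamma V e g) := by
  rw [h.gradGamma_eq_opY hg ht he]
  exact h.allLp_opY (h.tame_partialGamma _ ht) 0 e

end Gradient

section Pairing

variable {V : ℝ → ℝ} {δm δp β γ κ : ℝ} {f g : Conf → ℝ} {Λ : Finset ℤ} {u : ℤ → Conf → ℝ}

/-- The sum `∑_i ⟨u_i f⟩` has finitely many nonzero terms and equals `s`. -/
structure HasPairing (V : ℝ → ℝ) (β : ℝ) (u : ℤ → Conf → ℝ) (f : Conf → ℝ) (s : ℝ) :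
    Prop where
  allLp : AllLp V β f
  finite : (Function.support fun i => avg V β fun ω => u i ω * f ω).Finite
  eq : ∑ᶠ i, avg V β (fun ω => u i ω * f ω) = s

lemma HasPairing.add (hu : ∀ i, AllLp V β (u i)) {s t : ℝ} (hf : HasPairing V β u f s)
    (hg : HasPairing V β u g t) : HasPairing V β u (fun ω => f ω + g ω) (s + t) := by
  have e : (fun i => avg V β fun ω => u i ω * (f ω + g ω)) =
      fun i => avg V β (fun ω => u i ω * f ω) + avg V β (fun ω => u i ω * g ω) := by
    funext i
    rw [← avg_add ((hu i).mul hf.allLp) ((hu i).mul hg.allLp)]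
    simp only [mul_add]
  refine ⟨hf.allLp.add hg.allLp, ?_, ?_⟩
  · rw [e]
    exact (hf.finite.union hg.finite).subset (Function.support_add _ _)
  · rw [e, finsum_add_distrib hf.finite hg.finite, hf.eq, hg.eq]

lemma HasPairing.const_mul {s : ℝ} (hf : HasPairing V β u f s) (c : ℝ) :
    HasPairing V β u (fun ω => c * f ω) (c * s) := by
  have e : (fun i => avg V β fun ω => u i ω * (c * f ω)) =
      fun i => c * avg V β (fun ω => u i ω * f ω) := by
    funext i
    rw [← avg_const_mul]
    simp only [mul_left_comm]
  refine ⟨hf.allLp.const_mul c, ?_, ?_⟩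
  · rw [e]
    exact hf.finite.subset fun i hi => right_ne_zero_of_mul hi
  · rw [e, ← mul_finsum' _ _ hf.finite, hf.eq]

lemma HasPairing.sub (hu : ∀ i, AllLp V β (u i)) {s t : ℝ} (hf : HasPairing V β u f s)
    (hg : HasPairing V β u g t) : HasPairing V β u (fun ω => f ω - g ω) (s - t) := by
  simpa [sub_eq_add_neg] using HasPairing.add hu hf (hg.const_mul (-1))

lemma Admissible.hasPairing_sum (h : Admissible V δm δp β) (hu : ∀ i, AllLp V β (u i))
    {ι : Type*} (s : Finset ι) {F : ι → Conf → ℝ} {t : ι → ℝ}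
    (hF : ∀ i ∈ s, HasPairing V β u (F i) (t i)) :
    HasPairing V β u (fun ω => ∑ i ∈ s, F i ω) (∑ i ∈ s, t i) := by
  classical
  induction s using Finset.induction_on with
  | empty => exact ⟨by simpa using h.allLp_const 0, by simp [h.avg_const], by simp [h.avg_const]⟩
  | insert a s ha ih =>
    simp only [Finset.sum_insert ha]
    exact HasPairing.add hu (hF a (by simp)) (ih fun i hi => hF i (by simp [hi]))

lemma Admissible.hasPairing_opY (h : Admissible V δm δp β) (hu : ∀ i, Tame V β (u i))
    (hf : Tame V β f) (k l : ℤ) (K : Finset ℤ) (hK : ∀ i ∉ K, opY V k l (u i) = fun _ => 0) :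
    HasPairing V β u (opY V k l f)
      (-avg V β fun ω => (∑ i ∈ K, opY V k l (u i) ω) * f ω) := by
  have e : (fun i => avg V β fun ω => u i ω * opY V k l f ω) =
      fun i => -avg V β (fun ω => opY V k l (u i) ω * f ω) :=
    funext fun i => h.avg_mul_opY (hu i) hf k l
  have hs : (Function.support fun i => -avg V β (fun ω => opY V k l (u i) ω * f ω)) ⊆ K := by
    intro i hi
    by_contra hiK
    apply hi
    simp [hK i hiK, h.avg_const]
  refine ⟨h.allLp_opY hf k l, ?_, ?_⟩
  · rw [e]
    exact K.finite_toSet.subset hs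
  · rw [e, finsum_eq_sum_of_support_subset _ hs, Finset.sum_neg_distrib]
    simp only [Finset.sum_mul]
    rw [avg_sum]
    exact fun i _ => (h.allLp_opY (hu i) k l).mul hf.allLp

/-- A family `u` whose formal sum has the gradient `(τ_k v_0, τ_k v_1)` along the fields
`(X_k, Y_{k,k+1})`. -/
structure HasGradient (V : ℝ → ℝ) (β : ℝ) (u : ℤ → Conf → ℝ) (v : ℤ → Conf → ℝ) : Prop where
  tame : ∀ i, Tame V β (u i)
  allLp : ∀ e : ℤ, e = 0 ∨ e = 1 → AllLp V β (v e)
  pairing : ∀ f, Tame V β f → ∀ k e : ℤ, e = 0 ∨ e = 1 →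
    HasPairing V β u (opY V k (k + e) f) (-avg V β fun ω => v e ω * shift (-k) f ω)

lemma Admissible.avg_mul_shift (h : Admissible V δm δp β) (f g : Conf → ℝ) (j : ℤ) :
    avg V β (fun ω => f ω * shift j g ω) = avg V β fun ω => shift (-j) f ω * g ω := by
  rw [← h.avg_shift (-j)]
  have e : shift (-j) (fun ω => f ω * shift j g ω)
      = fun ω => shift (-j) f ω * shift (-j) (shift j g) ω := rfl
  rw [e, shift_shift]
  simp [shift_zero]

lemma Admissible.hasGradient_star (h : Admissible V δm δp β) (hg : DependsOn g (Λ : Set ℤ))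
    (ht : Tame V β g) :
    HasGradient V β (fun i => shift (-i) g) (fun e => gradGamma V e g) where
  tame i := h.tame_shift ht _
  allLp e he := h.allLp_gradGamma hg ht he
  pairing f hf k e he := by
    convert h.hasPairing_opY (fun i => h.tame_shift ht (-i)) hf k (k + e)
      ((bondSupport Λ).image fun m => m - k) (fun i hi => ?_) using 2
    · rw [h.avg_mul_shift, neg_neg, gradGamma_eq_sum hg he]
      congr 1
      funext ω
      congr 1
      rw [Finset.sum_image fun a _ b _ hab => by simpa using hab]
      refine Finset.sum_congr rfl fun m _ => ?_
      have : ∀ w : Conf → ℝ, shift k (opY V 0 e w) = opY V k (k + e) (shift k w) := by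
        intro w
        rw [opY_shift]
        congr 2 <;> ring
      rw [show (-(m - k) : ℤ) = k + -m by ring, ← shift_shift, ← this]
      rfl
    · have hi' : i + k ∉ bondSupport Λ := fun hm =>
        hi (Finset.mem_image.2 ⟨i + k, hm, by ring⟩)
      rw [opY_shift, show k - -i = i + k by ring, show k + e - -i = i + k + e by ring,
        opY_eq_zero_of_notMem_bondSupport hg he hi', shift_const]

lemma Admissible.opY_energy (h : Admissible V δm δp β) (k l i : ℤ) :
    opY V k l (energy V i) = fun ω => (ω k).1 * deriv V (ω l).2 *
      ((if i = l then 1 else 0) - if i = k then 1 else 0) := by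
  have e1 := (h.tame_half_p_sq i).dP_add (h.tame_V i) k
  have e2 := (h.tame_half_p_sq i).dR_add (h.tame_V i) l
  have d : deriv (fun x : ℝ => x ^ 2 / 2) = fun x => x := by
    funext x
    simp
  funext ω
  unfold opY energy
  rw [e1, e2, dP_comp_p (fun x => x ^ 2 / 2), dP_comp_r V, dR_comp_p (fun x => x ^ 2 / 2),
    dR_comp_r V, d]
  rcases eq_or_ne i l with rfl | h1 <;> rcases eq_or_ne i k with rfl | h2 <;>
    simp [*] <;> ring

lemma Admissible.hasGradient_starStar (h : Admissible V δm δp β) :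
    HasGradient V β (fun i ω => (i : ℝ) * energy V i ω)
      (fun e ω => if e = 1 then (ω 0).1 * deriv V (ω 1).2 else 0) where
  tame i := h.tame_const_mul (h.tame_energy i) i
  allLp e he := by
    rcases he with rfl | rfl
    · simpa using h.allLp_const 0
    · simpa using (h.allLp_p 0).mul (h.allLp_V' 1)
  pairing f hf k e he := by
    have hop : ∀ i : ℤ, opY V k (k + e) (fun ω => (i : ℝ) * energy V i ω) = fun ω =>
        i * ((ω k).1 * deriv V (ω (k + e)).2 *
          ((if i = k + e then 1 else 0) - if i = k then 1 else 0)) := fun i => by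
      rw [h.opY_const_mul (h.tame_energy i), h.opY_energy]
    convert h.hasPairing_opY (fun i => h.tame_const_mul (h.tame_energy i) (i : ℝ)) hf k (k + e)
      {k, k + 1} (fun i hi => ?_) using 2
    · rw [h.avg_mul_shift, neg_neg]
      congr 1
      funext ω
      congr 1
      rw [Finset.sum_pair (by simp), hop, hop]
      rcases he with rfl | rfl
      · simp [shift]
      · simp [shift, add_comm 1 k]
        ring
    · rw [hop]
      simp only [Finset.mem_insert, Finset.mem_singleton, not_or] at hi
      funext ω
      rcases he with rfl | rfl <;> simp [hi]

lemma opL_eq_sum (hf : DependsOn f (Λ : Set ℤ)) :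
    opL V γ f = fun ω => ∑ k ∈ bondSupport Λ,
      (γ / 2 * (opY V k (k + 0) (opY V k (k + 0) f) ω + opY V k (k + 1) (opY V k (k + 1) f) ω)
        + (opY V k (k + 0) f ω - opY V k (k + 1) f ω)) := by
  funext ω
  rw [Finset.sum_add_distrib, ← Finset.mul_sum]
  simp only [add_zero]
  have h0 : ∀ k ∉ bondSupport Λ, opY V k k f = fun _ => 0 := fun k hk => by
    simpa using opY_eq_zero_of_notMem_bondSupport (V := V) hf (Or.inl rfl) hk
  have h1 : ∀ k ∉ bondSupport Λ, opY V k (k + 1) f = fun _ => 0 := fun k hk =>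
    opY_eq_zero_of_notMem_bondSupport hf (Or.inr rfl) hk
  unfold opL opS opA opX
  congr 1
  · congr 1
    refine finsum_eq_sum_of_support_subset _ fun k hk => ?_
    by_contra hk'
    apply hk
    simp [h0 k hk', h1 k hk', opY_const]
  · refine finsum_eq_sum_of_support_subset _ fun k hk => ?_
    by_contra hk'
    apply hk
    simp [h0 k hk', h1 k hk']

lemma Admissible.hasPairing_opL (h : Admissible V δm δp β) {v : ℤ → Conf → ℝ}
    (hu : HasGradient V β u v) (hf : IsTest Λ f) :
    HasPairing V β u (opL V γ f)
      (-(γ / 2) * (avg V β (fun ω => v 0 ω * gradGamma V 0 f ω)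
          + avg V β (fun ω => v 1 ω * gradGamma V 1 f ω))
        - avg V β (fun ω => v 0 ω * partialGamma (bondSupport Λ) f ω)
        + avg V β (fun ω => v 1 ω * partialGamma (bondSupport Λ) f ω)) := by
  have ht := h.tame_of_isTest hf
  have hl : ∀ i, AllLp V β (u i) := fun i => (hu.tame i).allLp
  rw [opL_eq_sum hf.dependsOn]
  have key := h.hasPairing_sum hl (bondSupport Λ) fun k _ =>
    HasPairing.add hl
      ((HasPairing.add hl (hu.pairing _ (h.tame_opY_of_isTest hf k (k + 0)) k 0 (Or.inl rfl))
        (hu.pairing _ (h.tame_opY_of_isTest hf k (k + 1)) k 1 (Or.inr rfl))).const_mul (γ / 2))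
      (HasPairing.sub hl (hu.pairing _ ht k 0 (Or.inl rfl))
        (hu.pairing _ ht k 1 (Or.inr rfl)))
  convert key using 1
  have e1 : ∀ e : ℤ, e = 0 ∨ e = 1 → avg V β (fun ω => v e ω * gradGamma V e f ω)
      = ∑ k ∈ bondSupport Λ, avg V β fun ω => v e ω * shift (-k) (opY V k (k + e) f) ω := by
    intro e he
    rw [gradGamma_eq_sum hf.dependsOn he]
    simp only [Finset.mul_sum]
    rw [avg_sum _ fun k _ => (hu.allLp e he).mul (h.allLp_opY (h.tame_shift ht _) _ _)]
    refine Finset.sum_congr rfl fun k _ => ?_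
    rw [opY_shift]
    congr! 5 <;> ring
  have e2 : ∀ e : ℤ, e = 0 ∨ e = 1 →
      avg V β (fun ω => v e ω * partialGamma (bondSupport Λ) f ω)
      = ∑ k ∈ bondSupport Λ, avg V β fun ω => v e ω * shift (-k) f ω := by
    intro e he
    simp only [partialGamma, Finset.mul_sum]
    rw [avg_sum _ fun k _ => (hu.allLp e he).mul (h.tame_shift ht _).allLp]
  rw [e1 0 (Or.inl rfl), e1 1 (Or.inr rfl), e2 0 (Or.inl rfl), e2 1 (Or.inr rfl),
    Finset.sum_add_distrib, ← Finset.mul_sum, Finset.sum_add_distrib, Finset.sum_sub_distrib]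
  simp only [Finset.sum_neg_distrib]
  ring

/-! ### The energy gradient and the current -/

lemma Admissible.avg_p_sq_mul (h : Admissible V δm δp β) (hf : Tame V β f) (j : ℤ) :
    avg V β (fun ω => (ω j).1 ^ 2 * f ω)
      = β⁻¹ * (avg V β f + avg V β fun ω => (ω j).1 * dP j f ω) := by
  have e := h.avg_dP ((h.tame_p j).mul hf) j
  rw [(h.tame_p j).dP_mul hf, dP_comp_p fun x => x] at e
  simp only [if_true, deriv_id'', one_mul] at e
  rw [avg_add hf.allLp ((h.allLp_p j).mul (hf.allLp_dP j))] at e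
  rw [e, inv_mul_cancel_left₀ h.beta_pos.ne']
  congr 1
  funext ω
  ring

lemma Admissible.avg_p_sq (h : Admissible V δm δp β) (j : ℤ) :
    avg V β (fun ω => (ω j).1 ^ 2) = β⁻¹ := by
  simpa [dP_const, h.avg_const] using h.avg_p_sq_mul (h.tame_const 1) j

lemma Admissible.hasPairing_star_p_sq (h : Admissible V δm δp β)
    (hg : DependsOn g (Λ : Set ℤ)) (ht : Tame V β g) (h0 : avg V β g = 0) :
    HasPairing V β (fun i => shift (-i) g) (fun ω => (ω 1).1 ^ 2 - (ω 0).1 ^ 2) 0 := by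
  set c : ℤ → ℝ := fun i => avg V β fun ω => (ω i).1 ^ 2 * g ω with hc
  have hfin : (Function.support c).Finite := by
    refine Λ.finite_toSet.subset fun i hi => ?_
    by_contra hiΛ
    apply hi
    simp [hc, h.avg_p_sq_mul ht, h0, dP_eq_zero_of_dependsOn hg hiΛ, h.avg_const]
  have hfin' : (Function.support fun i => c (i + 1)).Finite :=
    hfin.preimage (add_left_injective (1 : ℤ)).injOn
  have e : (fun i => avg V β fun ω => shift (-i) g ω * ((ω 1).1 ^ 2 - (ω 0).1 ^ 2))
      = fun i => c (i + 1) - c i := by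
    funext i
    rw [← h.avg_mul_shift, hc]
    simp only
    rw [← avg_sub ((h.tame_p_sq _).allLp.mul ht.allLp) ((h.tame_p_sq _).allLp.mul ht.allLp)]
    congr 1
    funext ω
    simp only [shift, zero_add, add_comm 1 i]
    ring
  refine ⟨(h.tame_p_sq 1).allLp.sub (h.tame_p_sq 0).allLp, ?_, ?_⟩
  · rw [e]
    exact (hfin'.union hfin).subset (Function.support_sub _ _)
  · rw [e, finsum_sub_distrib hfin' hfin, sub_eq_zero]
    exact finsum_comp_equiv (Equiv.addRight (1 : ℤ))

lemma Admissible.hasPairing_starStar_p_sq (h : Admissible V δm δp β) :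
    HasPairing V β (fun i ω => (i : ℝ) * energy V i ω) (fun ω => (ω 1).1 ^ 2 - (ω 0).1 ^ 2)
      (β⁻¹ ^ 2) := by
  have e : (fun i : ℤ => avg V β fun ω => (i : ℝ) * energy V i ω * ((ω 1).1 ^ 2 - (ω 0).1 ^ 2))
      = fun i => if i = 1 then β⁻¹ ^ 2 else 0 := by
    funext i
    have hd : ∀ j, avg V β (fun ω => (ω j).1 * dP j (energy V i) ω)
        = if i = j then β⁻¹ else 0 := by
      intro j
      have e1 := (h.tame_half_p_sq i).dP_add (h.tame_V i) j
      have d : deriv (fun x : ℝ => x ^ 2 / 2) = fun x => x := by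
        funext x
        simp
      unfold energy
      rw [e1, dP_comp_p (fun x => x ^ 2 / 2), dP_comp_r V, d]
      rcases eq_or_ne i j with rfl | hij
      · simpa [sq] using h.avg_p_sq i
      · simp [hij, h.avg_const]
    have e2 : (fun ω : Conf => (i : ℝ) * energy V i ω * ((ω 1).1 ^ 2 - (ω 0).1 ^ 2))
        = fun ω => i * ((ω 1).1 ^ 2 * energy V i ω - (ω 0).1 ^ 2 * energy V i ω) := by
      funext ω
      ring
    rw [e2, avg_const_mul, avg_sub ((h.tame_p_sq 1).allLp.mul (h.tame_energy i).allLp)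
      ((h.tame_p_sq 0).allLp.mul (h.tame_energy i).allLp), h.avg_p_sq_mul (h.tame_energy i),
      h.avg_p_sq_mul (h.tame_energy i), hd, hd]
    rcases eq_or_ne i 1 with rfl | h1
    · simp
      ring
    · rcases eq_or_ne i 0 with rfl | h2
      · simp
      · simp [h1, h2]
  refine ⟨(h.tame_p_sq 1).allLp.sub (h.tame_p_sq 0).allLp, ?_, ?_⟩
  · rw [e]
    refine (Set.finite_singleton (1 : ℤ)).subset fun i hi => ?_
    by_contra h1
    exact hi (if_neg h1)
  · rw [e, finsum_eq_single _ 1 fun i hi => if_neg hi, if_pos rfl]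

/-- A primitive of the current along `Y_{0,1}`. -/
def currentPotential (V : ℝ → ℝ) (γ : ℝ) : Conf → ℝ := fun ω =>
  (ω 0).1 ^ 2 / 2 + γ / 2 * ((ω 0).1 * deriv V (ω 1).2)

lemma Admissible.tame_p_mul_V' (h : Admissible V δm δp β) (i j : ℤ) :
    Tame V β fun ω => (ω i).1 * deriv V (ω j).2 :=
  (h.tame_p i).mul (h.tame_V' j)

lemma Admissible.tame_currentPotential (h : Admissible V δm δp β) (γ : ℝ) :
    Tame V β (currentPotential V γ) :=
  (h.tame_half_p_sq 0).add (h.tame_const_mul (h.tame_p_mul_V' 0 1) _)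

lemma opY_half_p_sq (k l i : ℤ) :
    opY V k l (fun ω => (ω i).1 ^ 2 / 2)
      = fun ω => if i = k then -((ω k).1 * deriv V (ω l).2) else 0 := by
  have d : deriv (fun x : ℝ => x ^ 2 / 2) = fun x => x := by
    funext x
    simp
  funext ω
  unfold opY
  rw [dP_comp_p (fun x => x ^ 2 / 2), dR_comp_p (fun x => x ^ 2 / 2), d]
  rcases eq_or_ne i k with rfl | hik
  · simp
    ring
  · simp [hik]

lemma Admissible.opY_currentPotential (h : Admissible V δm δp β) (γ : ℝ) :
    opY V 0 1 (currentPotential V γ) = current V γ := by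
  unfold currentPotential
  rw [(h.tame_half_p_sq 0).opY_add (h.tame_const_mul (h.tame_p_mul_V' 0 1) _),
    h.opY_const_mul (h.tame_p_mul_V' 0 1), opY_half_p_sq]
  have e1 := (h.tame_p 0).dP_mul (h.tame_V' 1) 0
  have e2 := (h.tame_p 0).dR_mul (h.tame_V' 1) 1
  rw [dP_comp_p (fun x => x), dP_comp_r (deriv V)] at e1
  rw [dR_comp_p (fun x => x), dR_comp_r (deriv V)] at e2
  funext ω
  simp only [opY, e1, e2, current, if_true, deriv_id'']
  ring

/-- The value of a pairing on `W_{0,1} + κ (p_1² - p_0²) - L F`. -/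
lemma Admissible.hasPairing_current (h : Admissible V δm δp β) {v : ℤ → Conf → ℝ} {s : ℝ}
    (hu : HasGradient V β u v)
    (hs : HasPairing V β u (fun ω => (ω 1).1 ^ 2 - (ω 0).1 ^ 2) s) (hf : IsTest Λ f) :
    HasPairing V β u
      (fun ω => current V γ ω + κ * ((ω 1).1 ^ 2 - (ω 0).1 ^ 2) - opL V γ f ω)
      (-avg V β (fun ω => v 1 ω * currentPotential V γ ω) + κ * s
        + γ / 2 * (avg V β (fun ω => v 0 ω * gradGamma V 0 f ω)
          + avg V β (fun ω => v 1 ω * gradGamma V 1 f ω))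
        + avg V β (fun ω => v 0 ω * partialGamma (bondSupport Λ) f ω)
        - avg V β (fun ω => v 1 ω * partialGamma (bondSupport Λ) f ω)) := by
  have hl : ∀ i, AllLp V β (u i) := fun i => (hu.tame i).allLp
  have h1 := hu.pairing _ (h.tame_currentPotential γ) 0 1 (Or.inr rfl)
  rw [zero_add, h.opY_currentPotential, neg_zero, shift_zero] at h1
  convert HasPairing.sub hl (HasPairing.add hl h1 (hs.const_mul κ))
    (h.hasPairing_opL (γ := γ) hu hf) using 1
  ring

/-- The functional in the definition of the semi-norm, evaluated at
`W_{0,1} + κ (p_1² - p_0²) - L f`. -/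
lemma Admissible.functional_eq (h : Admissible V δm δp β) {Λ' : Finset ℤ}
    (hg : DependsOn g (Λ' : Set ℤ)) (ht : Tame V β g) (h0 : avg V β g = 0) (hf : IsTest Λ f)
    (a : ℝ) {v₀ v₁ : Conf → ℝ} (hv₀ : v₀ = gradGamma V 0 g)
    (hv₁ : v₁ = fun ω => a * ((ω 0).1 * deriv V (ω 1).2) + gradGamma V 1 g ω) :
    starForm V β g
        (fun ω => current V γ ω + κ * ((ω 1).1 ^ 2 - (ω 0).1 ^ 2) - opL V γ f ω)
      + a * starStarForm V β
        (fun ω => current V γ ω + κ * ((ω 1).1 ^ 2 - (ω 0).1 ^ 2) - opL V γ f ω)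
      = -avg V β (fun ω => v₁ ω * currentPotential V γ ω) + a * (κ * β⁻¹ ^ 2)
        + γ / 2 * (avg V β (fun ω => v₀ ω * gradGamma V 0 f ω)
          + avg V β (fun ω => v₁ ω * gradGamma V 1 f ω))
        + avg V β (fun ω => v₀ ω * partialGamma (bondSupport Λ) f ω)
        - avg V β (fun ω => v₁ ω * partialGamma (bondSupport Λ) f ω) := by
  have e1 := (h.hasPairing_current (γ := γ) (κ := κ) (h.hasGradient_star hg ht)
    (h.hasPairing_star_p_sq hg ht h0) hf).eq
  have e2 := (h.hasPairing_current (γ := γ) (κ := κ) h.hasGradient_starStar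
    h.hasPairing_starStar_p_sq hf).eq
  simp only [← h.avg_mul_shift] at e1
  have e3 : ∀ w, AllLp V β w → avg V β (fun ω => v₁ ω * w ω)
      = a * avg V β (fun ω => (ω 0).1 * deriv V (ω 1).2 * w ω)
        + avg V β (fun ω => gradGamma V 1 g ω * w ω) := by
    intro w hw
    rw [← avg_const_mul, ← avg_add
      (((h.tame_p_mul_V' 0 1).allLp.mul hw).const_mul a)
      ((h.allLp_gradGamma hg ht (Or.inr rfl)).mul hw), hv₁]
    congr 1
    funext ω
    ring
  have hF := h.tame_of_isTest hf
  rw [e3 _ (h.tame_currentPotential γ).allLp,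
    e3 _ (h.allLp_gradGamma hf.dependsOn hF (Or.inr rfl)),
    e3 _ (h.tame_partialGamma _ hF).allLp, hv₀]
  have e4 : starStarForm V β
      (fun ω => current V γ ω + κ * ((ω 1).1 ^ 2 - (ω 0).1 ^ 2) - opL V γ f ω)
      = ∑ᶠ i : ℤ, avg V β fun ω => (i : ℝ) * energy V i ω *
        (current V γ ω + κ * ((ω 1).1 ^ 2 - (ω 0).1 ^ 2) - opL V γ f ω) := by
    unfold starStarForm
    refine finsum_congr fun i => ?_
    rw [← avg_const_mul]
    congr 1
    funext ω
    ring
  rw [e4, e2, starForm, e1]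
  simp [h.avg_const]
  ring

end Pairing

section Dominated

variable {V : ℝ → ℝ} {δm δp β : ℝ} {a a' : ℕ → Conf → ℝ} {b b' : Conf → ℝ}

/-- Pointwise convergence dominated by a function in every `L^k(ν_β)`. -/
structure DomTendsto (V : ℝ → ℝ) (β : ℝ) (a : ℕ → Conf → ℝ) (b : Conf → ℝ) : Prop where
  allLp : ∀ n, AllLp V β (a n)
  bound : ∃ E, AllLp V β E ∧ ∀ n ω, |a n ω| ≤ E ω
  tendsto : ∀ ω, Filter.Tendsto (fun n => a n ω) Filter.atTop (nhds (b ω))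

lemma DomTendsto.avg (h : DomTendsto V β a b) :
    Filter.Tendsto (fun n => avg V β (a n)) Filter.atTop (nhds (avg V β b)) := by
  obtain ⟨E, hE, hb⟩ := h.bound
  exact tendsto_integral_of_dominated_convergence E
    (fun n => (h.allLp n).aestronglyMeasurable) hE.integrable
    (fun n => Filter.Eventually.of_forall (hb n)) (Filter.Eventually.of_forall h.tendsto)

lemma domTendsto_const (hb : AllLp V β b) : DomTendsto V β (fun _ => b) b :=
  ⟨fun _ => hb, ⟨_, hb.abs, fun _ _ => le_rfl⟩, fun _ => tendsto_const_nhds⟩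

lemma DomTendsto.mul (h : DomTendsto V β a b) (h' : DomTendsto V β a' b') :
    DomTendsto V β (fun n ω => a n ω * a' n ω) fun ω => b ω * b' ω := by
  obtain ⟨E, hE, hb⟩ := h.bound
  obtain ⟨E', hE', hb'⟩ := h'.bound
  refine ⟨fun n => (h.allLp n).mul (h'.allLp n), ⟨_, hE.mul hE', fun n ω => ?_⟩,
    fun ω => (h.tendsto ω).mul (h'.tendsto ω)⟩
  rw [abs_mul]
  exact mul_le_mul (hb n ω) (hb' n ω) (abs_nonneg _) ((abs_nonneg _).trans (hb n ω))

lemma DomTendsto.add (h : DomTendsto V β a b) (h' : DomTendsto V β a' b') :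
    DomTendsto V β (fun n ω => a n ω + a' n ω) fun ω => b ω + b' ω := by
  obtain ⟨E, hE, hb⟩ := h.bound
  obtain ⟨E', hE', hb'⟩ := h'.bound
  exact ⟨fun n => (h.allLp n).add (h'.allLp n), ⟨_, hE.add hE', fun n ω =>
    (abs_add_le _ _).trans (add_le_add (hb n ω) (hb' n ω))⟩,
    fun ω => (h.tendsto ω).add (h'.tendsto ω)⟩

lemma DomTendsto.neg (h : DomTendsto V β a b) :
    DomTendsto V β (fun n ω => -a n ω) fun ω => -b ω := by
  obtain ⟨E, hE, hb⟩ := h.bound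
  exact ⟨fun n => (h.allLp n).neg, ⟨E, hE, fun n ω => by simpa using hb n ω⟩,
    fun ω => (h.tendsto ω).neg⟩

lemma DomTendsto.sub (h : DomTendsto V β a b) (h' : DomTendsto V β a' b') :
    DomTendsto V β (fun n ω => a n ω - a' n ω) fun ω => b ω - b' ω := by
  simpa [sub_eq_add_neg] using h.add h'.neg

lemma Admissible.domTendsto_sum (h : Admissible V δm δp β) {ι : Type*} (s : Finset ι)
    {a : ι → ℕ → Conf → ℝ} {b : ι → Conf → ℝ} (ha : ∀ i ∈ s, DomTendsto V β (a i) (b i)) :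
    DomTendsto V β (fun n ω => ∑ i ∈ s, a i n ω) fun ω => ∑ i ∈ s, b i ω := by
  classical
  induction s using Finset.induction_on with
  | empty => simpa using domTendsto_const (h.allLp_const 0)
  | insert i s hi ih =>
    simp only [Finset.sum_insert hi]
    exact (ha i (by simp)).add (ih fun k hk => ha k (by simp [hk]))

lemma Admissible.domTendsto_shift (h : Admissible V δm δp β) (ha : DomTendsto V β a b) (j : ℤ) :
    DomTendsto V β (fun n => shift j (a n)) (shift j b) := by
  obtain ⟨E, hE, hb⟩ := ha.bound
  exact ⟨fun n => h.allLp_shift (ha.allLp n) j, ⟨_, h.allLp_shift hE j, fun n ω => hb n _⟩,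
    fun ω => ha.tendsto _⟩

lemma Admissible.domTendsto_of_real (h : Admissible V δm δp β) {c : ℕ → ℝ} {l : ℝ}
    (hc : Filter.Tendsto c Filter.atTop (nhds l)) :
    DomTendsto V β (fun n _ => c n) fun _ => l := by
  obtain ⟨M, hM⟩ := (Metric.isBounded_range_of_tendsto c hc).exists_norm_le
  exact ⟨fun n => h.allLp_const _, ⟨_, h.allLp_const M, fun n _ => hM _ ⟨n, rfl⟩⟩, fun _ => hc⟩

lemma DomTendsto.comp_add (h : DomTendsto V β a b) (N : ℕ) :
    DomTendsto V β (fun n => a (n + N)) b := by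
  obtain ⟨E, hE, hb⟩ := h.bound
  exact ⟨fun n => h.allLp _, ⟨E, hE, fun n => hb _⟩,
    fun ω => (h.tendsto ω).comp (Filter.tendsto_add_atTop_nat N)⟩

end Dominated

section Cutoff

variable {V : ℝ → ℝ} {δm δp β : ℝ}

/-- A sequence of smooth cutoffs in the coordinates of `Λ`. -/
structure IsCutoff (V : ℝ → ℝ) (β : ℝ) (Λ : Finset ℤ) (Θ : ℕ → Conf → ℝ) : Prop where
  isTest : ∀ n, IsTest Λ (Θ n)
  tendsto : DomTendsto V β Θ fun _ => 1
  tendsto_dP : ∀ i, DomTendsto V β (fun n => dP i (Θ n)) fun _ => 0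
  tendsto_dR : ∀ i, DomTendsto V β (fun n => dR i (Θ n)) fun _ => 0

lemma Admissible.exists_isCutoff (h : Admissible V δm δp β) (Λ : Finset ℤ) :
    ∃ Θ, IsCutoff V β Λ Θ := by
  let θ : ContDiffBump (0 : Λ → ℝ × ℝ) := ⟨1, 2, one_pos, one_lt_two⟩
  have hθ : ContDiff ℝ ((⊤ : ℕ∞) : WithTop ℕ∞) θ := θ.contDiff
  have hθc : HasCompactSupport θ := θ.hasCompactSupport
  set s : ℕ → ℝ := fun n => 1 / ((n : ℝ) + 1) with hs
  have hs0 : ∀ n, s n ≠ 0 := fun n => Nat.one_div_pos_of_nat.ne'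
  have hs1 : Filter.Tendsto s Filter.atTop (nhds 0) := tendsto_one_div_add_atTop_nhds_zero_nat
  have hsx : ∀ x : Λ → ℝ × ℝ, Filter.Tendsto (fun n => s n • x) Filter.atTop (nhds 0) := by
    intro x
    simpa using hs1.smul_const x
  let Θ : ℕ → Conf → ℝ := fun n ω => θ (s n • fun k : Λ => ω k)
  have hΘ : ∀ n, IsTest Λ (Θ n) := fun n =>
    ⟨fun x => θ (s n • x), hθ.comp (contDiff_const_smul _), hθc.comp_smul (hs0 n), fun _ => rfl⟩
  have hd : ∀ v : Λ → ℝ × ℝ, ∀ D : ℕ → Conf → ℝ, (∀ n, AllLp V β (D n)) →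
      (∀ n ω, D n ω = s n * fderiv ℝ θ (s n • fun k : Λ => ω k) v) →
      DomTendsto V β D fun _ => 0 := by
    intro v D hD hDe
    have hc := (hθ.continuous_fderiv (by simp)).clm_apply (continuous_const (y := v))
    obtain ⟨C, hC⟩ := (hθc.fderiv_apply (𝕜 := ℝ) v).exists_bound_of_continuous hc
    have hlim : ∀ ω : Conf, Filter.Tendsto
        (fun n => fderiv ℝ θ (s n • fun k : Λ => ω k) v) Filter.atTop
        (nhds (fderiv ℝ θ 0 v)) := fun ω => (hc.tendsto 0).comp (hsx _)
    refine ⟨hD, ⟨fun _ => C, h.allLp_const C, fun n ω => ?_⟩, fun ω => ?_⟩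
    · rw [hDe, abs_mul]
      have h1 : |s n| ≤ 1 := by
        rw [abs_of_pos Nat.one_div_pos_of_nat, hs]
        exact (div_le_one (by positivity)).2 (by linarith [(n.cast_nonneg : (0 : ℝ) ≤ n)])
      calc |s n| * |fderiv ℝ θ (s n • fun k : Λ => ω k) v| ≤ 1 * C :=
            mul_le_mul h1 (hC _) (abs_nonneg _) zero_le_one
        _ = C := one_mul C
    · simp only [hDe]
      simpa using hs1.mul (hlim ω)
  have hder : ∀ n (i : ℤ) (ω : Conf) (c : ℝ → ℝ × ℝ) (v : ℝ × ℝ) (t : ℝ),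
      HasDerivAt c v t → c t = ω i →
      deriv (fun x => Θ n (Function.update ω i (c x))) t
        = s n * fderiv ℝ θ (s n • fun k : Λ => ω k)
            (fun k : Λ => if (k : ℤ) = i then v else 0) := by
    intro n i ω c v t hc hct
    have hφ : Differentiable ℝ fun x : Λ → ℝ × ℝ => θ (s n • x) :=
      (hθ.differentiable (by simp)).comp (differentiable_id.const_smul (s n))
    have h1 := (hasDerivAt_comp_restrict_update hφ (ω := ω) (i := i) hc).deriv
    rw [hct, Function.update_eq_self] at h1
    refine h1.trans ?_
    have h2 : HasFDerivAt (fun x : Λ → ℝ × ℝ => θ (s n • x))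
        ((fderiv ℝ θ (s n • fun k : Λ => ω k)).comp (s n • ContinuousLinearMap.id ℝ _))
        (fun k : Λ => ω k) :=
      ((hθ.differentiable (by simp)) _).hasFDerivAt.comp _
        ((hasFDerivAt_id _).const_smul (s n))
    rw [h2.fderiv]
    simp
  refine ⟨Θ, hΘ, ⟨fun n => h.allLp_of_isTest (hΘ n), ⟨fun _ => 1, h.allLp_const 1,
    fun n ω => ?_⟩, fun ω => ?_⟩, fun i => ?_, fun i => ?_⟩
  · rw [abs_of_nonneg θ.nonneg]
    exact θ.le_one
  · have h1 : θ 0 = 1 := θ.one_of_mem_closedBall (by simp [θ])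
    rw [← h1]
    exact (hθ.continuous.tendsto 0).comp (hsx _)
  · exact hd (fun k : Λ => if (k : ℤ) = i then (1, 0) else 0) _
      (fun n => h.allLp_of_isTest ((hΘ n).dP i)) fun n ω =>
        hder n i ω (fun x => (x, (ω i).2)) (1, 0) _
          ((hasDerivAt_id _).prodMk (hasDerivAt_const _ _)) rfl
  · exact hd (fun k : Λ => if (k : ℤ) = i then (0, 1) else 0) _
      (fun n => h.allLp_of_isTest ((hΘ n).dR i)) fun n ω =>
        hder n i ω (fun x => ((ω i).1, x)) (0, 1) _
          ((hasDerivAt_const _ _).prodMk (hasDerivAt_id _)) rfl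

lemma IsCutoff.comp_add {Λ : Finset ℤ} {Θ : ℕ → Conf → ℝ} (hΘ : IsCutoff V β Λ Θ) (N : ℕ) :
    IsCutoff V β Λ fun n => Θ (n + N) :=
  ⟨fun _ => hΘ.isTest _, hΘ.tendsto.comp_add N, fun i => (hΘ.tendsto_dP i).comp_add N,
    fun i => (hΘ.tendsto_dR i).comp_add N⟩

/-- The gradient of a smooth local function of zero average is a dominated limit of gradients
of test functions. -/
lemma Admissible.exists_test_approx (h : Admissible V δm δp β) {Λ : Finset ℤ} {H : Conf → ℝ}
    {φ : (Λ → ℝ × ℝ) → ℝ} (hφ : ContDiff ℝ ((⊤ : ℕ∞) : WithTop ℕ∞) φ)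
    (hH : ∀ ω : Conf, H ω = φ fun i => ω i) (ht : Tame V β H) (h0 : avg V β H = 0) :
    ∃ g : ℕ → Conf → ℝ, (∀ n, IsTest Λ (g n) ∧ avg V β (g n) = 0) ∧
      ∀ e : ℤ, e = 0 ∨ e = 1 →
        DomTendsto V β (fun n => gradGamma V e (g n)) (gradGamma V e H) := by
  obtain ⟨Θ₀, hΘ₀⟩ := h.exists_isCutoff Λ
  have hev : ∀ᶠ n in Filter.atTop, avg V β (Θ₀ n) ≠ 0 := by
    refine hΘ₀.tendsto.avg.eventually_ne ?_
    rw [h.avg_const]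
    exact one_ne_zero
  obtain ⟨N, hN⟩ := Filter.eventually_atTop.1 hev
  obtain ⟨Θ, hΘ, hne⟩ : ∃ Θ, IsCutoff V β Λ Θ ∧ ∀ n, avg V β (Θ n) ≠ 0 :=
    ⟨_, hΘ₀.comp_add N, fun n => hN _ (Nat.le_add_left _ _)⟩
  have hDH := domTendsto_const ht.allLp
  set c : ℕ → ℝ := fun n => avg V β (fun ω => Θ n ω * H ω) / avg V β (Θ n) with hc
  have hc0 : Filter.Tendsto c Filter.atTop (nhds 0) := by
    have : Filter.Tendsto c Filter.atTop (nhds (avg V β (fun ω => 1 * H ω) /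
        avg V β fun _ => 1)) :=
      (hΘ.tendsto.mul hDH).avg.div hΘ.tendsto.avg (by simp [h.avg_const])
    simpa [h0, h.avg_const] using this
  have hDc := h.domTendsto_of_real hc0
  have hHc : ∀ n, Tame V β fun ω => H ω - c n := fun n => h.tame_sub ht (h.tame_const _)
  have hdHc : ∀ n i, dP i (fun ω => H ω - c n) = dP i H := fun n i => by
    funext ω
    exact deriv_sub_const _
  have hdHc' : ∀ n i, dR i (fun ω => H ω - c n) = dR i H := fun n i => by
    funext ω
    exact deriv_sub_const _
  let g : ℕ → Conf → ℝ := fun n ω => Θ n ω * (H ω - c n)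
  have hg : ∀ n, IsTest Λ (g n) := by
    intro n
    obtain ⟨θ, h1, h2, h3⟩ := hΘ.isTest n
    exact ⟨fun x => θ x * (φ x - c n), h1.mul (hφ.sub contDiff_const), h2.mul_right,
      fun ω => by simp [g, h3, hH]⟩
  have hdep : DependsOn H (Λ : Set ℤ) := by
    intro ω ω' hω
    rw [hH, hH]
    congr 1
    funext i
    exact hω i i.2
  have hP : ∀ i, DomTendsto V β (fun n => dP i (g n)) (dP i H) := by
    intro i
    have e : (fun n => dP i (g n)) = fun n ω => dP i (Θ n) ω * (H ω - c n) + Θ n ω * dP i H ω := by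
      funext n
      rw [(h.tame_of_isTest (hΘ.isTest n)).dP_mul (hHc n), hdHc]
    rw [e]
    simpa using ((hΘ.tendsto_dP i).mul (hDH.sub hDc)).add
      (hΘ.tendsto.mul (domTendsto_const (ht.allLp_dP i)))
  have hR : ∀ i, DomTendsto V β (fun n => dR i (g n)) (dR i H) := by
    intro i
    have e : (fun n => dR i (g n)) = fun n ω => dR i (Θ n) ω * (H ω - c n) + Θ n ω * dR i H ω := by
      funext n
      rw [(h.tame_of_isTest (hΘ.isTest n)).dR_mul (hHc n), hdHc']
    rw [e]
    simpa using ((hΘ.tendsto_dR i).mul (hDH.sub hDc)).add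
      (hΘ.tendsto.mul (domTendsto_const (ht.allLp_dR i)))
  refine ⟨g, fun n => ⟨hg n, ?_⟩, fun e he => ?_⟩
  · have e : g n = fun ω => Θ n ω * H ω - c n * Θ n ω := by
      funext ω
      simp only [g]
      ring
    rw [e, avg_sub ((hΘ.tendsto.allLp n).mul ht.allLp) ((hΘ.tendsto.allLp n).const_mul _),
      avg_const_mul, hc]
    simp only
    rw [div_mul_cancel₀ _ (hne n), sub_self]
  · rw [gradGamma_eq_sum hdep he]
    simp only [gradGamma_eq_sum (hg _).dependsOn he]
    refine h.domTendsto_sum _ fun k _ => ?_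
    unfold opY
    simp only [dP_shift, dR_shift]
    exact ((domTendsto_const (h.allLp_p 0)).mul (h.domTendsto_shift (hR _) _)).sub
      ((domTendsto_const (h.allLp_V' e)).mul (h.domTendsto_shift (hP _) _))

end Cutoff

section Moments

variable {V : ℝ → ℝ} {δm δp β : ℝ}

/-- The centred kinetic energy of the site `0`. -/
def kinetic (β : ℝ) : Conf → ℝ := fun ω => (ω 0).1 ^ 2 / 2 - (2 * β)⁻¹

lemma Admissible.tame_kinetic (h : Admissible V δm δp β) : Tame V β (kinetic β) :=
  h.tame_sub (h.tame_half_p_sq 0) (h.tame_const _)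

lemma Admissible.avg_half_p_sq (h : Admissible V δm δp β) :
    avg V β (fun ω => (ω 0).1 ^ 2 / 2) = (2 * β)⁻¹ := by
  simp only [div_eq_inv_mul]
  rw [avg_const_mul, h.avg_p_sq, mul_inv]

lemma Admissible.avg_kinetic (h : Admissible V δm δp β) : avg V β (kinetic β) = 0 := by
  unfold kinetic
  rw [avg_sub (h.tame_half_p_sq 0).allLp (h.allLp_const _), h.avg_const, h.avg_half_p_sq, sub_self]

lemma dP_kinetic (j : ℤ) : dP j (kinetic β) = fun ω => if 0 = j then (ω 0).1 else 0 := by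
  have d : deriv (fun x : ℝ => x ^ 2 / 2 - (2 * β)⁻¹) = fun x => x := by
    funext x
    simp
  unfold kinetic
  rw [dP_comp_p fun x => x ^ 2 / 2 - (2 * β)⁻¹, d]

lemma dR_kinetic (j : ℤ) : dR j (kinetic β) = fun _ => 0 :=
  dR_comp_p (fun x => x ^ 2 / 2 - (2 * β)⁻¹) 0 j

lemma opY_kinetic (e : ℤ) :
    opY V 0 e (kinetic β) = fun ω => -((ω 0).1 * deriv V (ω e).2) := by
  funext ω
  simp only [opY, dP_kinetic, dR_kinetic, if_true]
  ring

lemma Admissible.avg_kinetic_sq (h : Admissible V δm δp β) :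
    avg V β (fun ω => kinetic β ω * kinetic β ω) = β⁻¹ ^ 2 / 2 := by
  have e : (fun ω => kinetic β ω * kinetic β ω)
      = fun ω => 2⁻¹ * ((ω 0).1 ^ 2 * kinetic β ω) - (2 * β)⁻¹ * kinetic β ω := by
    funext ω
    simp only [kinetic]
    ring
  rw [e, avg_sub (((h.tame_p_sq 0).allLp.mul h.tame_kinetic.allLp).const_mul _)
    (h.tame_kinetic.allLp.const_mul _), avg_const_mul, avg_const_mul, h.avg_kinetic,
    h.avg_p_sq_mul h.tame_kinetic, h.avg_kinetic, dP_kinetic]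
  simp only [if_true, ← sq]
  rw [h.avg_p_sq]
  ring

lemma Admissible.avg_V'' (h : Admissible V δm δp β) (e : ℤ) :
    avg V β (fun ω => deriv (deriv V) (ω e).2) = avg V β fun ω => deriv (deriv V) (ω 0).2 := by
  rw [← h.avg_shift e fun ω => deriv (deriv V) (ω 0).2]
  unfold shift
  simp only [zero_add]

lemma Admissible.avg_p_mul_V'_sq (h : Admissible V δm δp β) (e : ℤ) :
    avg V β (fun ω => (ω 0).1 * deriv V (ω e).2 * ((ω 0).1 * deriv V (ω e).2))
      = β⁻¹ ^ 2 * avg V β fun ω => deriv (deriv V) (ω 0).2 := by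
  have ht := (h.tame_V' e).mul (h.tame_V' e)
  have e1 := h.avg_p_sq_mul ht 0
  rw [(h.tame_V' e).dP_mul (h.tame_V' e), dP_comp_r (deriv V)] at e1
  have e2 := h.avg_dR (h.tame_V' e) e
  rw [dR_comp_r (deriv V)] at e2
  simp only [if_true] at e2
  rw [h.avg_V''] at e2
  have e3 : (fun ω : Conf => (ω 0).1 * deriv V (ω e).2 * ((ω 0).1 * deriv V (ω e).2))
      = fun ω => (ω 0).1 ^ 2 * (deriv V (ω e).2 * deriv V (ω e).2) := by
    funext ω
    ring
  rw [e3, e1, e2]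
  simp only [zero_mul, mul_zero, add_zero, h.avg_const]
  have := h.beta_pos.ne'
  field_simp

lemma Admissible.avg_p_mul_V'_mul_kinetic (h : Admissible V δm δp β) (e : ℤ) :
    avg V β (fun ω => (ω 0).1 * deriv V (ω e).2 * kinetic β ω) = 0 := by
  have e1 := h.avg_dR ((h.tame_p 0).mul h.tame_kinetic) e
  rw [(h.tame_p 0).dR_mul h.tame_kinetic, dR_comp_p (fun x => x), dR_kinetic] at e1
  simp only [zero_mul, mul_zero, add_zero, h.avg_const] at e1
  have e2 := (mul_eq_zero.1 e1.symm).resolve_left h.beta_pos.ne'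
  rw [← e2]
  congr 1
  funext ω
  ring

lemma Admissible.avg_sq_combination (h : Admissible V δm δp β) (e : ℤ) (c : ℝ) :
    avg V β (fun ω => ((ω 0).1 * deriv V (ω e).2 + c * kinetic β ω) *
        ((ω 0).1 * deriv V (ω e).2 + c * kinetic β ω))
      = β⁻¹ ^ 2 * avg V β (fun ω => deriv (deriv V) (ω 0).2) + c ^ 2 * (β⁻¹ ^ 2 / 2) := by
  have hP := (h.tame_p_mul_V' 0 e).allLp
  have hk := h.tame_kinetic.allLp
  have e1 : (fun ω : Conf => ((ω 0).1 * deriv V (ω e).2 + c * kinetic β ω) *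
        ((ω 0).1 * deriv V (ω e).2 + c * kinetic β ω))
      = fun ω => (ω 0).1 * deriv V (ω e).2 * ((ω 0).1 * deriv V (ω e).2)
        + (2 * c * ((ω 0).1 * deriv V (ω e).2 * kinetic β ω)
          + c ^ 2 * (kinetic β ω * kinetic β ω)) := by
    funext ω
    ring
  rw [e1, avg_add (hP.mul hP) (((hP.mul hk).const_mul _).add ((hk.mul hk).const_mul _)),
    avg_add ((hP.mul hk).const_mul _) ((hk.mul hk).const_mul _), avg_const_mul, avg_const_mul,
    h.avg_p_mul_V'_sq, h.avg_p_mul_V'_mul_kinetic, h.avg_kinetic_sq]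
  ring

/-- `⟨u²⟩ - ⟨u w⟩ ≥ - ⟨w²⟩ / (4 (1 - t)) + t ⟨u²⟩`. -/
lemma sq_sub_mul_ge {u w : Conf → ℝ} (hu : AllLp V β u) (hw : AllLp V β w) {t : ℝ}
    (ht : t < 1) :
    -(avg V β (fun ω => w ω * w ω) / (4 * (1 - t)))
      ≤ (1 - t) * avg V β (fun ω => u ω * u ω) - avg V β fun ω => u ω * w ω := by
  have h1 : 0 ≤ avg V β fun ω => ((1 - t) * u ω - 2⁻¹ * w ω) * ((1 - t) * u ω - 2⁻¹ * w ω) :=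
    integral_nonneg fun ω => mul_self_nonneg _
  have e1 : (fun ω => ((1 - t) * u ω - 2⁻¹ * w ω) * ((1 - t) * u ω - 2⁻¹ * w ω))
      = fun ω => (1 - t) ^ 2 * (u ω * u ω) - ((1 - t) * (u ω * w ω) - 4⁻¹ * (w ω * w ω)) := by
    funext ω
    ring
  rw [e1, avg_sub ((hu.mul hu).const_mul _)
    (((hu.mul hw).const_mul _).sub ((hw.mul hw).const_mul _)),
    avg_sub ((hu.mul hw).const_mul _) ((hw.mul hw).const_mul _), avg_const_mul, avg_const_mul,
    avg_const_mul] at h1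
  have hs : 0 < 1 - t := by linarith
  rw [neg_le_iff_add_nonneg, ← sub_nonneg]
  have : (1 - t) * avg V β (fun ω => u ω * u ω) - avg V β (fun ω => u ω * w ω)
      + avg V β (fun ω => w ω * w ω) / (4 * (1 - t)) - 0
      = ((1 - t) ^ 2 * avg V β (fun ω => u ω * u ω) - ((1 - t) * avg V β (fun ω => u ω * w ω)
        - 4⁻¹ * avg V β (fun ω => w ω * w ω))) / (1 - t) := by
    field_simp
    ring
  rw [this]
  exact div_nonneg h1 hs.le

end Moments

section Bound

variable {V : ℝ → ℝ} {δm δp β γ κ : ℝ} {F : Conf → ℝ} {Λ : Finset ℤ}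

/-- The functional of the semi-norm at `W_{0,1} + κ (p_1² - p_0²) - L F`, in terms of the
gradient `(v₀, v₁)` of the test function. -/
def gradFunctional (V : ℝ → ℝ) (β γ κ : ℝ) (Λ : Finset ℤ) (F : Conf → ℝ) (a : ℝ)
    (v₀ v₁ : Conf → ℝ) : ℝ :=
  2 * (-avg V β (fun ω => v₁ ω * currentPotential V γ ω) + a * (κ * β⁻¹ ^ 2)
        + γ / 2 * (avg V β (fun ω => v₀ ω * gradGamma V 0 F ω)
          + avg V β (fun ω => v₁ ω * gradGamma V 1 F ω))
        + avg V β (fun ω => v₀ ω * partialGamma (bondSupport Λ) F ω)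
        - avg V β (fun ω => v₁ ω * partialGamma (bondSupport Λ) F ω))
    - γ / 2 * avg V β (fun ω => v₁ ω * v₁ ω) - γ / 2 * avg V β (fun ω => v₀ ω * v₀ ω)

lemma Admissible.gradFunctional_lt (h : Admissible V δm δp β) (hF : IsTest Λ F) {ε : ℝ}
    (hε : seminormSq V β γ
      (fun ω => current V γ ω + κ * ((ω 1).1 ^ 2 - (ω 0).1 ^ 2) - opL V γ F ω) < (ε : EReal))
    {Λ' : Finset ℤ} {g : Conf → ℝ} (hg : IsTest Λ' g) (h0 : avg V β g = 0) (a : ℝ) :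
    gradFunctional V β γ κ Λ F a (gradGamma V 0 g)
      (fun ω => a * ((ω 0).1 * deriv V (ω 1).2) + gradGamma V 1 g ω) < ε := by
  have hmem : g ∈ testFunctions V β := ⟨⟨Λ', hg⟩, h0⟩
  have h1 := lt_of_le_of_lt (le_iSup₂_of_le g hmem (le_iSup_of_le a le_rfl)) hε
  have h2 := EReal.coe_lt_coe_iff.1 h1
  rw [gradFunctional, ← h.functional_eq hg.dependsOn (h.tame_of_isTest hg) h0 hF a rfl rfl]
  rw [XGamma_eq_gradGamma, YGamma_eq_gradGamma] at h2
  simp only [← sq]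
  linarith

lemma Admissible.tendsto_gradFunctional (h : Admissible V δm δp β) (hF : IsTest Λ F) (a : ℝ)
    {a₀ a₁ : ℕ → Conf → ℝ} {v₀ v₁ : Conf → ℝ} (h₀ : DomTendsto V β a₀ v₀)
    (h₁ : DomTendsto V β a₁ v₁) :
    Filter.Tendsto (fun n => gradFunctional V β γ κ Λ F a (a₀ n) (a₁ n)) Filter.atTop
      (nhds (gradFunctional V β γ κ Λ F a v₀ v₁)) := by
  have hT := h.tame_of_isTest hF
  have hX := domTendsto_const (h.allLp_gradGamma hF.dependsOn hT (Or.inl rfl))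
  have hY := domTendsto_const (h.allLp_gradGamma hF.dependsOn hT (Or.inr rfl))
  have hG := domTendsto_const (h.tame_partialGamma (bondSupport Λ) hT).allLp
  have hψ := domTendsto_const (h.tame_currentPotential γ).allLp
  exact ((((((h₁.mul hψ).avg.neg.add_const _).add
    (((h₀.mul hX).avg.add (h₁.mul hY).avg).const_mul _)).add (h₀.mul hG).avg).sub
    (h₁.mul hG).avg).const_mul 2).sub ((h₁.mul h₁).avg.const_mul _) |>.sub
    ((h₀.mul h₀).avg.const_mul _)

/-- The gradient of `t (Γ_F + ∑_j p_j² / 2)`. -/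
lemma Admissible.gradGamma_add_kinetic (h : Admissible V δm δp β) (hF : IsTest Λ F) (t : ℝ)
    {e : ℤ} (he : e = 0 ∨ e = 1) :
    gradGamma V e (fun ω => t * (F ω + kinetic β ω))
      = fun ω => t * (gradGamma V e F ω - (ω 0).1 * deriv V (ω e).2) := by
  have hT := h.tame_of_isTest hF
  have hk := h.tame_kinetic
  have hFd : DependsOn F ((insert 0 Λ : Finset ℤ) : Set ℤ) :=
    hF.dependsOn.mono (by simp)
  have hkd : DependsOn (kinetic β) ((insert 0 Λ : Finset ℤ) : Set ℤ) := by
    intro ω ω' hω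
    simp [kinetic, hω 0 (by simp)]
  have hd : DependsOn (fun ω => t * (F ω + kinetic β ω)) ((insert 0 Λ : Finset ℤ) : Set ℤ) := by
    intro ω ω' hω
    simp only [hFd hω, hkd hω]
  have hsum : (fun ω => ∑ k ∈ bondSupport (insert 0 Λ), opY V 0 e (shift (-k) (kinetic β)) ω)
      = fun ω => -((ω 0).1 * deriv V (ω e).2) := by
    funext ω
    have hz : ∀ k : ℤ, opY V 0 e (shift (-k) (kinetic β)) ω
        = if k = 0 then -((ω 0).1 * deriv V (ω e).2) else 0 := by
      intro k
      rcases eq_or_ne k 0 with rfl | hk0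
      · rw [neg_zero, shift_zero, opY_kinetic, if_pos rfl]
      · simp only [opY, dP_shift, dR_shift, dP_kinetic, dR_kinetic, shift_const, if_neg hk0]
        simp [shift, hk0.symm]
    simp only [hz]
    rw [Finset.sum_ite_eq' (bondSupport (insert 0 Λ)) 0, if_pos (by simp [bondSupport])]
  rw [gradGamma_eq_sum hd he, gradGamma_eq_sum hFd he]
  funext ω
  have hop : ∀ k, opY V 0 e (shift (-k) fun ω => t * (F ω + kinetic β ω)) ω
      = t * (opY V 0 e (shift (-k) F) ω + opY V 0 e (shift (-k) (kinetic β)) ω) := by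
    intro k
    have hTs := h.tame_shift hT (-k)
    have hks := h.tame_shift hk (-k)
    have := h.opY_const_mul (hTs.add hks) t 0 e
    rw [hTs.opY_add hks] at this
    exact congrFun this ω
  simp only [hop]
  rw [← Finset.mul_sum, Finset.sum_add_distrib, congrFun hsum ω, sub_eq_add_neg]

lemma Admissible.gradFunctional_le (h : Admissible V δm δp β) (hF : IsTest Λ F)
    (h0 : avg V β F = 0) {ε : ℝ}
    (hε : seminormSq V β γ
      (fun ω => current V γ ω + κ * ((ω 1).1 ^ 2 - (ω 0).1 ^ 2) - opL V γ F ω) < (ε : EReal))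
    (t : ℝ) :
    gradFunctional V β γ κ Λ F t
      (fun ω => t * (gradGamma V 0 F ω - (ω 0).1 * deriv V (ω 0).2))
      (fun ω => t * gradGamma V 1 F ω) ≤ ε := by
  have hT := h.tame_of_isTest hF
  have hk := h.tame_kinetic
  obtain ⟨φ, h1, h2, h3⟩ := id hF
  obtain ⟨g, hg, hlim⟩ := h.exists_test_approx (Λ := insert 0 Λ)
    (H := fun ω => t * (F ω + kinetic β ω))
    (φ := fun x => t * (φ (fun i : Λ => x ⟨i, Finset.mem_insert_of_mem i.2⟩)
      + ((x ⟨0, Finset.mem_insert_self 0 Λ⟩).1 ^ 2 / 2 - (2 * β)⁻¹)))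
    (by
      refine contDiff_const.mul ((h1.comp (contDiff_pi.2 fun i => contDiff_apply _ _ _)).add ?_)
      refine ContDiff.sub (ContDiff.div_const (ContDiff.pow ?_ 2) 2) contDiff_const
      exact contDiff_fst.comp (contDiff_apply _ _ _))
    (fun ω => by simp [h3, kinetic])
    (h.tame_const_mul (hT.add hk) t)
    (by rw [avg_const_mul, avg_add hT.allLp hk.allLp, h0, h.avg_kinetic]; simp)
  have h₀ := hlim 0 (Or.inl rfl)
  have h₁ := (domTendsto_const ((h.tame_p_mul_V' 0 1).allLp.const_mul t)).add
    (hlim 1 (Or.inr rfl))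
  rw [h.gradGamma_add_kinetic hF t (Or.inl rfl)] at h₀
  rw [h.gradGamma_add_kinetic hF t (Or.inr rfl)] at h₁
  have e : (fun ω : Conf => t * ((ω 0).1 * deriv V (ω 1).2)
      + t * (gradGamma V 1 F ω - (ω 0).1 * deriv V (ω 1).2))
      = fun ω => t * gradGamma V 1 F ω := by
    funext ω
    ring
  rw [e] at h₁
  exact le_of_tendsto (h.tendsto_gradFunctional hF t h₀ h₁)
    (Filter.Eventually.of_forall fun n =>
      (h.gradFunctional_lt hF hε (hg n).1 (hg n).2 t).le)

lemma Admissible.gradFunctional_ge (h : Admissible V δm δp β) (hγ : 0 < γ) (hF : IsTest Λ F)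
    {t : ℝ} (ht0 : 0 < t) (ht1 : t < 1) {v : ℝ}
    (hv : v = avg V β fun ω => deriv (deriv V) (ω 0).2) :
    2 * t * (κ * β⁻¹ ^ 2 - γ / 4 * (β⁻¹ ^ 2 * v + (2 / γ) ^ 2 * (β⁻¹ ^ 2 / 2)) / (1 - t)
      - γ / 2 * t * (β⁻¹ ^ 2 * v)) ≤
    gradFunctional V β γ κ Λ F t
      (fun ω => t * (gradGamma V 0 F ω - (ω 0).1 * deriv V (ω 0).2))
      (fun ω => t * gradGamma V 1 F ω) := by
  have hT := h.tame_of_isTest hF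
  have hk := h.tame_kinetic
  set G := partialGamma (bondSupport Λ) F with hG
  have hGt : Tame V β G := h.tame_partialGamma _ hT
  have hgrad : ∀ e : ℤ, e = 0 ∨ e = 1 → gradGamma V e F = opY V 0 e G := fun e he =>
    h.gradGamma_eq_opY hF.dependsOn hT he
  have hself : ∀ e, avg V β (fun ω => opY V 0 e G ω * G ω) = 0 := by
    intro e
    have e1 := h.avg_mul_opY hGt hGt 0 e
    have e2 : (fun ω => G ω * opY V 0 e G ω) = fun ω => opY V 0 e G ω * G ω :=
      funext fun ω => mul_comm _ _
    rw [e2] at e1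
    linarith
  have hkin : ∀ e, avg V β (fun ω => (ω 0).1 * deriv V (ω e).2 * G ω)
      = avg V β (fun ω => opY V 0 e G ω * kinetic β ω) := by
    intro e
    have e1 := h.avg_mul_opY hGt hk 0 e
    rw [opY_kinetic] at e1
    rw [← neg_inj, ← e1, ← avg_neg]
    congr 1
    funext ω
    ring
  rw [gradFunctional, ← hG, hgrad 0 (Or.inl rfl), hgrad 1 (Or.inr rfl)]
  set X := opY V 0 0 G with hX
  set Y := opY V 0 1 G with hY
  set P : ℤ → Conf → ℝ := fun e ω => (ω 0).1 * deriv V (ω e).2 with hP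
  have lX : AllLp V β X := h.allLp_opY hGt 0 0
  have lY : AllLp V β Y := h.allLp_opY hGt 0 1
  have lP : ∀ e, AllLp V β (P e) := fun e => (h.tame_p_mul_V' 0 e).allLp
  have lk := hk.allLp
  have lG := hGt.allLp
  have i1 : avg V β (fun ω => t * Y ω * currentPotential V γ ω)
      = t * (avg V β (fun ω => Y ω * kinetic β ω) + γ / 2 * avg V β (fun ω => Y ω * P 1 ω)) := by
    have e1 : (fun ω => t * Y ω * currentPotential V γ ω) = fun ω =>
        t * (Y ω * kinetic β ω + (γ / 2 * (Y ω * P 1 ω) + (2 * β)⁻¹ * Y ω)) := by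
      funext ω
      simp only [currentPotential, kinetic, hP]
      ring
    rw [e1, avg_const_mul, avg_add (lY.mul lk)
      (((lY.mul (lP 1)).const_mul _).add (lY.const_mul _)),
      avg_add ((lY.mul (lP 1)).const_mul _) (lY.const_mul _), avg_const_mul, avg_const_mul,
      hY, h.avg_opY hGt]
    ring
  have i2 : avg V β (fun ω => t * (X ω - P 0 ω) * X ω)
      = t * (avg V β (fun ω => X ω * X ω) - avg V β (fun ω => X ω * P 0 ω)) := by
    have e1 : (fun ω => t * (X ω - P 0 ω) * X ω) = fun ω => t * (X ω * X ω - X ω * P 0 ω) := by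
      funext ω
      ring
    rw [e1, avg_const_mul, avg_sub (lX.mul lX) (lX.mul (lP 0))]
  have i3 : avg V β (fun ω => t * Y ω * Y ω) = t * avg V β (fun ω => Y ω * Y ω) := by
    simp only [mul_assoc]
    rw [avg_const_mul]
  have i4 : avg V β (fun ω => t * (X ω - P 0 ω) * G ω)
      = -(t * avg V β (fun ω => X ω * kinetic β ω)) := by
    have e1 : (fun ω => t * (X ω - P 0 ω) * G ω) = fun ω => t * (X ω * G ω - P 0 ω * G ω) := by
      funext ω
      ring
    rw [e1, avg_const_mul, avg_sub (lX.mul lG) ((lP 0).mul lG), hself, hkin]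
    ring
  have i5 : avg V β (fun ω => t * Y ω * G ω) = 0 := by
    simp only [mul_assoc]
    rw [avg_const_mul, hself, mul_zero]
  have i6 : avg V β (fun ω => t * Y ω * (t * Y ω)) = t ^ 2 * avg V β (fun ω => Y ω * Y ω) := by
    rw [← avg_const_mul]
    congr 1
    funext ω
    ring
  have i7 : avg V β (fun ω => t * (X ω - P 0 ω) * (t * (X ω - P 0 ω)))
      ≤ t ^ 2 * (2 * avg V β (fun ω => X ω * X ω) + 2 * avg V β (fun ω => P 0 ω * P 0 ω)) := by
    have lS := ((lX.mul lX).const_mul 2).add (((lP 0).mul (lP 0)).const_mul 2)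
    rw [← avg_const_mul, ← avg_const_mul, ← avg_add ((lX.mul lX).const_mul 2)
      (((lP 0).mul (lP 0)).const_mul 2), ← avg_const_mul]
    refine integral_mono (((lX.sub (lP 0)).const_mul t).mul
      ((lX.sub (lP 0)).const_mul t)).integrable (lS.const_mul _).integrable fun ω => ?_
    simp only
    nlinarith [sq_nonneg (t * (X ω + P 0 ω))]
  have hYY : 0 ≤ avg V β (fun ω => Y ω * Y ω) := integral_nonneg fun ω => mul_self_nonneg _
  have hR : ∀ (u : Conf → ℝ) (e : ℤ), AllLp V β u →
      -((β⁻¹ ^ 2 * v + (2 / γ) ^ 2 * (β⁻¹ ^ 2 / 2)) / (4 * (1 - t)))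
        ≤ (1 - t) * avg V β (fun ω => u ω * u ω) - (avg V β (fun ω => u ω * P e ω)
          + 2 / γ * avg V β (fun ω => u ω * kinetic β ω)) := by
    intro u e lu
    have e1 := sq_sub_mul_ge lu ((lP e).add (lk.const_mul (2 / γ))) ht1
    rw [h.avg_sq_combination, ← hv] at e1
    refine e1.trans_eq ?_
    congr 1
    rw [← avg_const_mul, ← avg_add (lu.mul (lP e)) ((lu.mul lk).const_mul _)]
    congr 1
    funext ω
    ring
  have rX := hR X 0 lX
  have rY := hR Y 1 lY
  have hq := h.avg_p_mul_V'_sq 0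
  rw [← hv] at hq
  change avg V β (fun ω => P 0 ω * P 0 ω) = _ at hq
  rw [i1, i2, i3, i4, i5, i6]
  rw [hq] at i7
  set B := β⁻¹ ^ 2 * v + (2 / γ) ^ 2 * (β⁻¹ ^ 2 / 2)
  set xx := avg V β (fun ω => X ω * X ω)
  set yy := avg V β (fun ω => Y ω * Y ω)
  set xk := avg V β (fun ω => X ω * kinetic β ω)
  set yk := avg V β (fun ω => Y ω * kinetic β ω)
  set xp := avg V β (fun ω => X ω * P 0 ω)
  set yp := avg V β (fun ω => Y ω * P 1 ω)
  set Z := avg V β (fun ω => t * (X ω - P 0 ω) * (t * (X ω - P 0 ω)))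
  have c1 : γ / 4 * B / (1 - t) = γ * (B / (4 * (1 - t))) := by
    have : (1 - t) ≠ 0 := by linarith
    field_simp
  have c2 : γ * (2 / γ) = 2 := by field_simp
  rw [c1]
  have m1 := mul_le_mul_of_nonneg_left (add_le_add rX rY) (mul_pos ht0 hγ).le
  have m2 := mul_le_mul_of_nonneg_left i7 hγ.le
  have m3 := mul_nonneg (mul_nonneg hγ.le (sq_nonneg t)) hYY
  have m4 : t * γ * ((1 - t) * xx - (xp + 2 / γ * xk) + ((1 - t) * yy - (yp + 2 / γ * yk)))
      = t * γ * ((1 - t) * (xx + yy) - xp - yp) - t * (γ * (2 / γ)) * (xk + yk) := by ring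
  rw [m4, c2] at m1
  nlinarith [m1, m2, m3]

/-- The bound obtained from the test function `F + p_0² / 2`. -/
theorem Admissible.diffusionConstant_le (h : Admissible V δm δp β) (hγ : 0 < γ)
    (hκ : IsDiffusionConstant V β γ κ) :
    κ ≤ γ / 4 * avg V β (fun ω => deriv (deriv V) (ω 0).2) + 1 / (2 * γ) := by
  obtain ⟨v, hv⟩ : ∃ v, v = avg V β fun ω => deriv (deriv V) (ω 0).2 := ⟨_, rfl⟩
  rw [← hv]
  set B := β⁻¹ ^ 2 * v + (2 / γ) ^ 2 * (β⁻¹ ^ 2 / 2) with hB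
  have key : ∀ t ∈ Set.Ioo (0 : ℝ) 1,
      κ * β⁻¹ ^ 2 ≤ t / 2 + γ / 4 * B / (1 - t) + γ / 2 * t * (β⁻¹ ^ 2 * v) := by
    intro t ht
    obtain ⟨F, ⟨⟨Λ, hF⟩, h0⟩, hε⟩ := hκ (t ^ 2) (pow_pos ht.1 2)
    have h1 := (h.gradFunctional_ge (κ := κ) hγ hF ht.1 ht.2 hv).trans
      (h.gradFunctional_le hF h0 hε t)
    have h2 : 2 * (κ * β⁻¹ ^ 2 - γ / 4 * B / (1 - t) - γ / 2 * t * (β⁻¹ ^ 2 * v)) ≤ t := by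
      refine le_of_mul_le_mul_left ?_ ht.1
      linarith
    linarith
  have hlim : Filter.Tendsto
      (fun t : ℝ => t / 2 + γ / 4 * B / (1 - t) + γ / 2 * t * (β⁻¹ ^ 2 * v))
      (nhdsWithin 0 (Set.Ioi 0)) (nhds (γ / 4 * B)) := by
    have hc : ContinuousAt
        (fun t : ℝ => t / 2 + γ / 4 * B / (1 - t) + γ / 2 * t * (β⁻¹ ^ 2 * v)) 0 := by
      have : (1 - 0 : ℝ) ≠ 0 := by norm_num
      fun_prop (disch := assumption)
    have := hc.tendsto
    simp only [zero_div, sub_zero, div_one, mul_zero, zero_mul, zero_add, add_zero] at this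
    exact this.mono_left nhdsWithin_le_nhds
  have h1 : κ * β⁻¹ ^ 2 ≤ γ / 4 * B :=
    ge_of_tendsto hlim (Filter.eventually_of_mem (Ioo_mem_nhdsGT one_pos) key)
  have h2 : γ / 4 * B = (γ / 4 * v + 1 / (2 * γ)) * β⁻¹ ^ 2 := by
    rw [hB]
    field_simp
    ring
  rw [h2] at h1
  exact le_of_mul_le_mul_right h1 (pow_pos (inv_pos.2 h.beta_pos) 2)

end Bound

end

end AnharmonicChain

theorem mainTheorem3 (V : ℝ → ℝ) (hV_nonneg : ∀ r, 0 ≤ V r)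
    (hV_smooth : ContDiff ℝ ((⊤ : ℕ∞) : WithTop ℕ∞) V)
    (hV_symm : ∀ r, V (-r) = V r) (δm δp : ℝ) (hδm : 0 < δm)
    (hV_lower : ∀ r, δm ≤ deriv (deriv V) r) (hV_upper : ∀ r, deriv (deriv V) r ≤ δp)
    (hδ : ((3 : ℝ) / 4) ^ ((1 : ℝ) / 16) < δm / δp)
    (β γ : ℝ) (hβ : 0 < β) (hγ : 0 < γ)
    (κ : ℝ) (hκ : AnharmonicChain.IsDiffusionConstant V β γ κ) :
    κ ≤ γ / 4 * AnharmonicChain.avg V β (fun ω => deriv (deriv V) (ω 0).2) + 3 / (4 * γ) := by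
  have h : AnharmonicChain.Admissible V δm δp β :=
    ⟨hV_nonneg, hV_smooth, hV_symm, hδm, hV_lower, hV_upper, hβ⟩
  refine (h.diffusionConstant_le hγ hκ).trans (add_le_add_right ?_ _)
  rw [div_le_div_iff₀ (by positivity) (by positivity)]
  linarith
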